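/- **Setting.** Let $\mathcal G$ be a finite simplicial graph with vertex set $I$, let $(G_i)_{i\in I}$ be finite groups, and let $\Gamma$ be their graph product, i.e. the quotient of the free product $*_{i}G_i$ by the normal closure of the commutators $ghg^{-1}h^{-1}$ with $g\in G_i$, $h\in G_j$ and $i,j$ adjacent. For $J\subset I$ let $\Gamma_J$ be the subgroup generated by the $G_j$, $j\in J$; let $j^\perp$ be the set of vertices adjacent to $j$, and $j^{\underline\perp}=\{j\}\cup j^\perp$. Let $\bar N$ be the set of spherical subsets of $I$ (sets of pairwise adjacent vertices, including $\emptyset$). Let $\Delta$ be the associated right-angled building. It is the cube complex with vertices $[\gamma,J]$ ($\gamma\in\Gamma$, $J\in\bar N$), where $[\gamma,J]=[\gamma',J']$ iff $J=J'$ and $\gamma^{-1}\gamma'\in\Gamma_J$, whose cubes are spanned by the sets $\{[\gamma,J]: J_1\subset J\subset J_2\}$, of dimension $|J_2-J_1|$, for $\gamma\in\Gamma$ and $J_1\subset J_2$ in $\bar N$. The standard typing map is $t_\Gamma([\gamma,J])=J$, and $\operatorname{rk}(v)=|t_\Gamma(v)|$. The chamber $C_\gamma$ is the subcomplex with vertices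 $[\gamma,J]$, $J\in\bar N$; its center is $[\gamma,\emptyset]$. Chambers $C_\gamma\ne C_{\gamma'}$ are $i$-adjacent if $\gamma^{-1}\gamma'\in G_i$, and adjacent if they are $i$-adjacent for some $i$. For $J\subset I$, $\mathcal C(J,C)$ is the set of chambers that can be joined to $C$ by a sequence of chambers in which consecutive ones are $j$-adjacent for some $j\in J$. Write $u\le v$ if $t_\Gamma(u)\subset t_\Gamma(v)$ and some chamber contains both $u$ and $v$. The lower degree $d^-(v)$ is the number of edges joining $v$ to a vertex of lower rank. Vertices $v_1,v_2$ are level-adjacent if they lie in adjacent chambers $C_1,C_2$ respectively, with $v_1,v_2\notin C_1\cap C_2$, and there is a vertex $u\in C_1\cap C_2$ with $v_1,v_2\le u$ and $\operatorname{rk}(v_1)=\operatorname{rk}(v_2)=\operatorname{rk}(u)-1$; level-equivalence is the equivalence relation generated by this, $[v]$ is the class of $v$, and $\mathcal C([v])$ is the set of chambers containing a vertex of $[v]$. $\operatorname{Aut}_{\operatorname{rk}}(\Delta)$ is the group of rank-preserving cubical automorphisms of $\Delta$. If $t_\Gamma(v)=\{j\}$ and $v\in C=C_\gamma$, then $\mathcal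 C([v])=\mathcal C(j^{\underline\perp},C)$, and there is a product decomposition $$\mathcal C(\{j\},C)\times\mathcal C(j^\perp,C)\cong\mathcal C([v]),\qquad (C_{\gamma\gamma_1},C_{\gamma\gamma_2})\mapsto C_{\gamma\gamma_1\gamma_2}\quad(\gamma_1\in G_j,\ \gamma_2\in\Gamma_{j^\perp}).\tag{$*$}$$ A *typing map* is a map $t$ from the vertices of $\Delta$ to $\bar N$ such that (1) for each chamber $C$ there is a center-preserving cubical isomorphism $\phi:C\to C_1$ onto the base chamber (that of $1\in\Gamma$) with $t(v)=t_\Gamma(\phi v)$ for all vertices $v\in C$; and (2) $d^-(v)=|G_i|$ whenever $t(v)=\{i\}$. A *typed atlas* $(t,\mathcal A)$ is a typing map $t$ with homomorphisms $\mathcal A_{[v]}:G_i\to\operatorname{Sym}(\mathcal C([v]))$, one for each class $[v]$ of rank-1 vertices, where $t(v)=\{i\}$ ($i$ depends only on $[v]$), such that this action of $G_i$ preserves the product decomposition $(*)$, and is simply transitive on the first factor and trivial on the second. For $F\in\operatorname{Aut}_{\operatorname{rk}}(\Delta)$, the equation $F_*(t,\mathcal A)=(t',\mathcal A')$ means that $t'(Fv)=t(v)$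 for all vertices $v$, and $\mathcal A'_{[Fv]}(g)(FC)=F\,\mathcal A_{[v]}(g)(C)$ whenever $t(v)=\{i\}$, $g\in G_i$ and $C\in\mathcal C([v])$. **Proposition.** Let $(t,\mathcal A)$ and $(t',\mathcal A')$ be typed atlases and let $C,C'$ be chambers of $\Delta$. There is a unique cubical isomorphism $f:C\to C'$ with $t'(fv)=t(v)$ for all vertices $v\in C$, and $f$ admits a unique extension $\bar f\in\operatorname{Aut}_{\operatorname{rk}}(\Delta)$ such that $\bar f_*(t,\mathcal A)=(t',\mathcal A')$. -/

import Mathlib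

/-!
Right-angled buildings of graph products, rank, level-equivalence, and typed atlases.

The cube complex `Δ` is treated combinatorially: it is given by its vertex set together with the
vertex sets of its cubes. A cube of `Δ` is determined by its vertex set, and the faces of a cube
are exactly the cubes contained in it.
-/

namespace RAB

universe u v

/-- The relators `g h g⁻¹ h⁻¹` with `g ∈ G i`, `h ∈ G j` and `i`, `j` adjacent. -/
def relators {I : Type u} (𝒢 : SimpleGraph I) (G : I → Type v) [∀ i, Group (G i)] :
    Set (Monoid.CoprodI G) :=
  {x | ∃ (i j : I) (g : G i) (h : G j), 𝒢.Adj i j ∧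
    x = Monoid.CoprodI.of g * Monoid.CoprodI.of h *
      (Monoid.CoprodI.of g)⁻¹ * (Monoid.CoprodI.of h)⁻¹}

/-- The graph product `Γ(𝒢, (G i))`. -/
abbrev GraphProduct {I : Type u} (𝒢 : SimpleGraph I) (G : I → Type v) [∀ i, Group (G i)] :
    Type (max u v) :=
  Monoid.CoprodI G ⧸ Subgroup.normalClosure (relators 𝒢 G)

section

variable {I : Type u} (𝒢 : SimpleGraph I) (G : I → Type v) [∀ i, Group (G i)]

/-- The canonical homomorphism `G i → Γ`. -/
def ofVertex (i : I) : G i →* GraphProduct 𝒢 G :=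
  (QuotientGroup.mk' (Subgroup.normalClosure (relators 𝒢 G))).comp Monoid.CoprodI.of

/-- The subgroup `Γ_J` generated by the vertex groups `G j` with `j ∈ J`. -/
def subgroupOf (J : Set I) : Subgroup (GraphProduct 𝒢 G) :=
  ⨆ j ∈ J, (ofVertex 𝒢 G j).range

/-- The poset `N̄` of simplices (with the empty one) of the flag completion of `𝒢`, i.e. of
spherical subsets of `I`. -/
abbrev Spherical : Type u := {J : Finset I // 𝒢.IsClique (J : Set I)}

/-- The empty simplex. -/
def Spherical.empty : Spherical 𝒢 := ⟨∅, by simp⟩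

/-- The relation `(γ, p) ∼ (γ', p')` on `Γ × C(N)`, for vertices `p`, `p'` of the cubical cone
`C(N)`; these are identified with their types in `N̄`. -/
def vertexSetoid : Setoid (GraphProduct 𝒢 G × Spherical 𝒢) where
  r x y := x.2 = y.2 ∧ x.1⁻¹ * y.1 ∈ subgroupOf 𝒢 G (x.2.1 : Set I)
  iseqv :=
    { refl := fun x => ⟨rfl, by simp⟩
      symm := by
        rintro ⟨a, J⟩ ⟨b, K⟩ ⟨h1, h2⟩
        dsimp only at h1 h2 ⊢
        subst h1
        refine ⟨rfl, ?_⟩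
        have := inv_mem h2
        simpa using this
      trans := by
        rintro ⟨a, J⟩ ⟨b, K⟩ ⟨c, L⟩ ⟨h1, h2⟩ ⟨h3, h4⟩
        dsimp only at h1 h2 h3 h4 ⊢
        subst h1 h3
        refine ⟨rfl, ?_⟩
        have := mul_mem h2 h4
        simpa [mul_assoc] using this }

/-- The vertex set `Δ⁰` of the right-angled building. -/
def Vertex : Type (max u v) := Quotient (vertexSetoid 𝒢 G)

/-- The vertex `[γ, p]`, where `p` is the vertex of `C(N)` of type `J`. -/
def vtx (γ : GraphProduct 𝒢 G) (J : Spherical 𝒢) : Vertex 𝒢 G :=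
  Quotient.mk (vertexSetoid 𝒢 G) (γ, J)

/-- The standard typing map `t_Γ : Δ⁰ → N̄`. -/
def stdType : Vertex 𝒢 G → Spherical 𝒢 :=
  Quotient.lift (fun x => x.2) (fun _ _ h => h.1)

/-- The rank of a vertex. -/
def rk (w : Vertex 𝒢 G) : ℕ := (stdType 𝒢 G w).1.card

/-- `Q` is (the vertex set of) an `n`-dimensional cube of `Δ`: the image in `Δ` of
`{γ} × (the cube of C(N) given by J₁ ⊆ J₂)`, where `|J₂ - J₁| = n`. -/
def IsCube (n : ℕ) (Q : Set (Vertex 𝒢 G)) : Prop :=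
  ∃ (γ : GraphProduct 𝒢 G) (J₁ J₂ : Spherical 𝒢), J₁.1 ⊆ J₂.1 ∧ J₂.1.card = J₁.1.card + n ∧
    Q = {w | ∃ J : Spherical 𝒢, J₁.1 ⊆ J.1 ∧ J.1 ⊆ J₂.1 ∧ w = vtx 𝒢 G γ J}

/-- The (vertex set of the) chamber `C_γ`. -/
def chamber (γ : GraphProduct 𝒢 G) : Set (Vertex 𝒢 G) := Set.range (vtx 𝒢 G γ)

/-- The center of `C_γ`. -/
def center (γ : GraphProduct 𝒢 G) : chamber 𝒢 G γ :=
  ⟨vtx 𝒢 G γ (Spherical.empty 𝒢), Set.mem_range_self _⟩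

/-- The set `𝒞(Δ)` of all chambers. -/
def chambers : Set (Set (Vertex 𝒢 G)) := Set.range (chamber 𝒢 G)

variable {𝒢 G} in
/-- A bijection between the vertex sets of two full subcomplexes of `Δ` (such as chambers) is a
cubical isomorphism if it matches the cubes of the first with those of the second. -/
def IsCubicalIso {S T : Set (Vertex 𝒢 G)} (f : S ≃ T) : Prop :=
  ∀ (n : ℕ) (Q : Set S),
    IsCube 𝒢 G n (Subtype.val '' Q) ↔ IsCube 𝒢 G n (Subtype.val '' (f '' Q))

/-- The group `Aut(Δ)` of cubical automorphisms. -/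
def Aut : Subgroup (Equiv.Perm (Vertex 𝒢 G)) where
  carrier := {F | ∀ (n : ℕ) (Q : Set (Vertex 𝒢 G)), IsCube 𝒢 G n Q ↔ IsCube 𝒢 G n (F '' Q)}
  one_mem' := fun n Q => by simp
  mul_mem' := fun {a b} ha hb n Q => by
    rw [hb n Q, ha n (b '' Q), Equiv.Perm.coe_mul, Set.image_comp]
  inv_mem' := fun {a} ha n Q => by
    rw [ha n (⇑a⁻¹ '' Q), ← Set.image_comp, ← Equiv.Perm.coe_mul]
    simp

/-- The group `Aut_rk(Δ)` of rank-preserving cubical automorphisms. -/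
def AutRk : Subgroup (Equiv.Perm (Vertex 𝒢 G)) where
  carrier := {F | F ∈ Aut 𝒢 G ∧ ∀ w, rk 𝒢 G (F w) = rk 𝒢 G w}
  one_mem' := ⟨one_mem _, fun _ => rfl⟩
  mul_mem' := fun {a b} ha hb =>
    ⟨mul_mem ha.1 hb.1, fun w => (ha.2 (b w)).trans (hb.2 w)⟩
  inv_mem' := fun {a} ha =>
    ⟨inv_mem ha.1, fun w => by simpa using (ha.2 (a⁻¹ w)).symm⟩

/-- The partial order on `Δ⁰`. -/
def VLE (x y : Vertex 𝒢 G) : Prop :=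
  (stdType 𝒢 G x).1 ⊆ (stdType 𝒢 G y).1 ∧ ∃ C ∈ chambers 𝒢 G, x ∈ C ∧ y ∈ C

/-- The set `E⁻(w)` of edges joining `w` to a vertex of lower rank. -/
def lowerEdges (w : Vertex 𝒢 G) : Set (Set (Vertex 𝒢 G)) :=
  {e | IsCube 𝒢 G 1 e ∧ w ∈ e ∧ ∃ x ∈ e, rk 𝒢 G x < rk 𝒢 G w}

/-- The lower degree `d⁻(w)`. -/
noncomputable def lowerDegree (w : Vertex 𝒢 G) : ℕ∞ := (lowerEdges 𝒢 G w).encard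

/-- `i`-adjacency of chambers. -/
def IAdj (i : I) (C D : Set (Vertex 𝒢 G)) : Prop :=
  ∃ γ₁ γ₂ : GraphProduct 𝒢 G, C = chamber 𝒢 G γ₁ ∧ D = chamber 𝒢 G γ₂ ∧
    γ₁⁻¹ * γ₂ ≠ 1 ∧ γ₁⁻¹ * γ₂ ∈ (ofVertex 𝒢 G i).range

/-- The `J`-chamber-residue `𝒞(J, C)` of a chamber `C`: the chambers that are joined to `C` by a
`J`-gallery. -/
def residue (J : Set I) (C : Set (Vertex 𝒢 G)) : Set (Set (Vertex 𝒢 G)) :=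
  {D | Relation.ReflTransGen (fun A B => ∃ j ∈ J, IAdj 𝒢 G j A B) C D}

/-- Level-adjacency of vertices. -/
def LevelAdj (x y : Vertex 𝒢 G) : Prop :=
  ∃ C₁ C₂ : Set (Vertex 𝒢 G), (∃ i, IAdj 𝒢 G i C₁ C₂) ∧ x ∈ C₁ ∧ y ∈ C₂ ∧
    x ∉ C₁ ∩ C₂ ∧ y ∉ C₁ ∩ C₂ ∧
    ∃ z ∈ C₁ ∩ C₂, VLE 𝒢 G x z ∧ VLE 𝒢 G y z ∧
      rk 𝒢 G z = rk 𝒢 G x + 1 ∧ rk 𝒢 G z = rk 𝒢 G y + 1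

/-- Level-equivalence: the equivalence relation generated by level-adjacency. -/
def levelSetoid : Setoid (Vertex 𝒢 G) := Relation.EqvGen.setoid (LevelAdj 𝒢 G)

/-- The type of level-equivalence classes. -/
def LevelClass : Type (max u v) := Quotient (levelSetoid 𝒢 G)

variable {𝒢 G} in
/-- The level-equivalence class `[w]`. -/
def levelClass (w : Vertex 𝒢 G) : LevelClass 𝒢 G := Quotient.mk (levelSetoid 𝒢 G) w

variable {𝒢 G} in
/-- The set `𝒞([w])` of chambers that contain a vertex of the level-equivalence class `[w]`. -/
def chambersOf (c : LevelClass 𝒢 G) : Set (Set (Vertex 𝒢 G)) :=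
  {C | C ∈ chambers 𝒢 G ∧ ∃ x ∈ C, levelClass x = c}

/-- The product decomposition `𝒞({j}, C) × 𝒞(j^⊥, C) ≅ 𝒞({j} ∪ j^⊥, C)`, as the graph of the
bijection: if `C = C_γ`, it sends `(C_{γγ₁}, C_{γγ₂})` with `γ₁ ∈ Γ_{j}` and `γ₂ ∈ Γ_{j^⊥}` to
`C_{γγ₁γ₂}`. Here `ProductRel j C C₁ C₂ D` says that `D` has coordinates `(C₁, C₂)`. -/
def ProductRel (j : I) (C C₁ C₂ D : Set (Vertex 𝒢 G)) : Prop :=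
  ∃ (γ γ₁ γ₂ : GraphProduct 𝒢 G), γ₁ ∈ subgroupOf 𝒢 G {j} ∧
    γ₂ ∈ subgroupOf 𝒢 G (𝒢.neighborSet j) ∧ C = chamber 𝒢 G γ ∧
    C₁ = chamber 𝒢 G (γ * γ₁) ∧ C₂ = chamber 𝒢 G (γ * γ₂) ∧ D = chamber 𝒢 G (γ * γ₁ * γ₂)

/-- Typing maps `t : Δ⁰ → N̄`. -/
structure IsTypingMap (t : Vertex 𝒢 G → Spherical 𝒢) : Prop where
  /-- Every chamber has a center-preserving cubical isomorphism to the base chamber that takes `t`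
  to the standard typing map. -/
  exists_iso : ∀ γ : GraphProduct 𝒢 G, ∃ φ : chamber 𝒢 G γ ≃ chamber 𝒢 G 1,
    IsCubicalIso φ ∧ φ (center 𝒢 G γ) = center 𝒢 G 1 ∧
      ∀ w : chamber 𝒢 G γ, t w = stdType 𝒢 G (φ w)
  /-- The lower degree of a vertex with `t`-type `{i}` is the order of `G i`. -/
  lowerDegree_eq : ∀ (i : I) (w : Vertex 𝒢 G), (t w).1 = {i} →
    lowerDegree 𝒢 G w = ENat.card (G i)

/-- Typed atlases `(t, 𝒜)`. The family `𝒜` is indexed by the level-equivalence classes `c` that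
contain a vertex `w` with `t(w)` a singleton `{i}`, i.e. by the classes of rank-1 vertices (and
`i` is determined by `c`). -/
structure TypedAtlas where
  /-- The typing map `t`. -/
  t : Vertex 𝒢 G → Spherical 𝒢
  isTypingMap : IsTypingMap 𝒢 G t
  /-- The homomorphisms `𝒜_[w] : G i → 𝔖(𝒞([w]))`, where `t(w) = {i}`. -/
  atlas : ∀ (c : LevelClass 𝒢 G) (i : I), (∃ w, levelClass w = c ∧ (t w).1 = {i}) →
    (G i →* Equiv.Perm (chambersOf c))
  /-- `G i` preserves the product decomposition of `𝒞([w])`, it acts simply transitively on the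
  first factor and trivially on the second. -/
  product_action : ∀ (w : Vertex 𝒢 G) (i j : I) (hi : (t w).1 = {i}),
    (stdType 𝒢 G w).1 = {j} → ∀ C ∈ chambers 𝒢 G, w ∈ C →
    ∃ ρ : G i →* Equiv.Perm (residue 𝒢 G {j} C),
      (∀ x y : residue 𝒢 G {j} C, ∃! g : G i, ρ g x = y) ∧
      ∀ (g : G i) (C₁ : residue 𝒢 G {j} C) (C₂ : residue 𝒢 G (𝒢.neighborSet j) C)
        (D : chambersOf (levelClass w)),
        ProductRel 𝒢 G j C C₁ C₂ D →
        ProductRel 𝒢 G j C (ρ g C₁) C₂ (atlas (levelClass w) i ⟨w, rfl, hi⟩ g D)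

variable {𝒢 G} in
/-- The equation `F_*(t, 𝒜) = (t', 𝒜')` for a rank-preserving automorphism `F` of `Δ`: we have
`t'(F w) = t(w)` for every vertex `w`, and `𝒜'_[F w](g)(F C) = F(𝒜_[w](g)(C))` whenever
`t(w) = {i}`, `g ∈ G i` and `C ∈ 𝒞([w])`; it is part of this that `F C ∈ 𝒞([F w])`. -/
def IsPushforward (F : AutRk 𝒢 G) (𝔸 𝔸' : TypedAtlas 𝒢 G) : Prop :=
  ∃ ht : ∀ w, 𝔸'.t (F.1 w) = 𝔸.t w,
    ∀ (w : Vertex 𝒢 G) (i : I) (hi : (𝔸.t w).1 = {i}) (g : G i) (C : chambersOf (levelClass w)),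
      ∃ hC : F.1 '' (C : Set (Vertex 𝒢 G)) ∈ chambersOf (levelClass (F.1 w)),
        (𝔸'.atlas (levelClass (F.1 w)) i ⟨F.1 w, rfl, by rw [ht w]; exact hi⟩ g ⟨_, hC⟩ :
            Set (Vertex 𝒢 G)) =
          F.1 '' (𝔸.atlas (levelClass w) i ⟨w, rfl, hi⟩ g C : Set (Vertex 𝒢 G))

end

end RAB

/-! Identify the chamber `C_γ` with `γ`. A typed atlas lets `G i` act on all chambers at once: `g`
moves `C_γ` by the permutation attached to the class of its rank-1 vertex of type `{i}`. Since these
permutations respect the product decomposition and are trivial on its second factor, adjacent vertex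
groups commute (`move_move`), so the graph product acts (`action`).

The heart of the proof is that this action is simply transitive. At each `γ`, the right translation
by `h ∈ G j` is effected by an element `elt` in the image of a vertex group. These elements satisfy
a cocycle identity and commute for adjacent vertices, so right translation lifts to an action on
pairs (chamber, element), `transport`, whose second entry records an element leading from the base
chamber to the current one. The chamber reached determines the translation, hence the recorded
element (`action_injective`).

Therefore sending `[h, J]` to the vertex of type `J` in the chamber `h⁻¹ · C_γ` is a rank-preserving
automorphism (`develop`). Developing one atlas backwards and the other forwards gives the extension.
It is unique because a pushforward intertwines the two actions, so one chamber determines the images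
of all chambers, and types determine the map on each chamber. -/

namespace RAB

universe u v

/-! ### Graph products, retractions onto `Γ_J`, and vertices of chambers. -/

section GraphProductBasics

variable {I : Type u} {𝒢 : SimpleGraph I} {G : I → Type v} [∀ i, Group (G i)]

/-- Elements of vertex groups of adjacent vertices commute in the graph product. -/
theorem ofVertex_commute {i j : I} (hij : 𝒢.Adj i j) (g : G i) (h : G j) :
    Commute (ofVertex 𝒢 G i g) (ofVertex 𝒢 G j h) := by
  have hmem : (Monoid.CoprodI.of g * Monoid.CoprodI.of h *
      (Monoid.CoprodI.of g)⁻¹ * (Monoid.CoprodI.of h)⁻¹ : Monoid.CoprodI G) ∈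
      Subgroup.normalClosure (relators 𝒢 G) :=
    Subgroup.subset_normalClosure ⟨i, j, g, h, hij, rfl⟩
  have h1 := (QuotientGroup.eq_one_iff _).2 hmem
  simp only [QuotientGroup.mk_mul, QuotientGroup.mk_inv] at h1
  rw [mul_inv_eq_one, mul_inv_eq_iff_eq_mul] at h1
  exact h1

/-- The universal property of the graph product. -/
def lift {H : Type*} [Group H] (f : ∀ i, G i →* H)
    (hf : ∀ i j, 𝒢.Adj i j → ∀ g h, Commute (f i g) (f j h)) : GraphProduct 𝒢 G →* H :=
  QuotientGroup.lift _ (Monoid.CoprodI.lift f) (by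
    intro x hx
    have : Subgroup.normalClosure (relators 𝒢 G) ≤ (Monoid.CoprodI.lift f).ker := by
      refine Subgroup.normalClosure_le_normal ?_
      rintro _ ⟨i, j, g, h, hij, rfl⟩
      have := (hf i j hij g h).eq
      simp [MonoidHom.mem_ker, this]
    exact this hx)

@[simp]
theorem lift_ofVertex {H : Type*} [Group H] (f : ∀ i, G i →* H)
    (hf : ∀ i j, 𝒢.Adj i j → ∀ g h, Commute (f i g) (f j h)) (i : I) (g : G i) :
    lift f hf (ofVertex 𝒢 G i g) = f i g := by
  change Monoid.CoprodI.lift f (Monoid.CoprodI.of g) = _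
  simp

theorem ofVertex_mem_subgroupOf {J : Set I} {i : I} (hi : i ∈ J) (g : G i) :
    ofVertex 𝒢 G i g ∈ subgroupOf 𝒢 G J :=
  (le_iSup₂_of_le (f := fun j (_ : j ∈ J) => (ofVertex 𝒢 G j).range) i hi le_rfl) ⟨g, rfl⟩

theorem subgroupOf_le_iff {J : Set I} {H : Subgroup (GraphProduct 𝒢 G)} :
    subgroupOf 𝒢 G J ≤ H ↔ ∀ j ∈ J, ∀ g, ofVertex 𝒢 G j g ∈ H := by
  simp only [subgroupOf, iSup_le_iff]
  refine forall₂_congr fun j _ => ⟨fun h g => h ⟨g, rfl⟩, ?_⟩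
  rintro h _ ⟨g, rfl⟩
  exact h g

theorem subgroupOf_univ : subgroupOf 𝒢 G Set.univ = ⊤ := by
  refine (Subgroup.eq_top_iff' _).2 fun x => ?_
  obtain ⟨x, rfl⟩ := QuotientGroup.mk_surjective x
  induction x using Monoid.CoprodI.induction_on with
  | one => exact one_mem _
  | of i g => exact ofVertex_mem_subgroupOf (𝒢 := 𝒢) (Set.mem_univ i) g
  | mul x y hx hy => exact mul_mem hx hy

theorem subgroupOf_empty : subgroupOf 𝒢 G ∅ = ⊥ := by simp [subgroupOf]

theorem subgroupOf_singleton (j : I) : subgroupOf 𝒢 G {j} = (ofVertex 𝒢 G j).range := by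
  simp [subgroupOf]

theorem subgroupOf_eq_closure (J : Set I) :
    subgroupOf 𝒢 G J = Subgroup.closure {x | ∃ j ∈ J, ∃ g, x = ofVertex 𝒢 G j g} := by
  refine le_antisymm (subgroupOf_le_iff.2 fun j hj g => Subgroup.subset_closure ⟨j, hj, g, rfl⟩)
    ((Subgroup.closure_le _).2 ?_)
  rintro _ ⟨j, hj, g, rfl⟩
  exact ofVertex_mem_subgroupOf hj g

theorem subgroupOf_induction_left {J : Set I} {P : GraphProduct 𝒢 G → Prop} (one : P 1)
    (mul : ∀ j ∈ J, ∀ g : G j, ∀ x ∈ subgroupOf 𝒢 G J, P x → P (ofVertex 𝒢 G j g * x))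
    {x : GraphProduct 𝒢 G} (hx : x ∈ subgroupOf 𝒢 G J) : P x := by
  rw [subgroupOf_eq_closure] at hx
  induction hx using Subgroup.closure_induction_left with
  | one => exact one
  | mul_left y hy z hz ih =>
    obtain ⟨j, hj, g, rfl⟩ := hy
    exact mul j hj g _ (by rwa [subgroupOf_eq_closure]) ih
  | inv_mul_cancel y hy z hz ih =>
    obtain ⟨j, hj, g, rfl⟩ := hy
    rw [← map_inv]
    exact mul j hj _ _ (by rwa [subgroupOf_eq_closure]) ih

theorem subgroupOf_induction_right {J : Set I} {P : GraphProduct 𝒢 G → Prop} (one : P 1)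
    (mul : ∀ x ∈ subgroupOf 𝒢 G J, ∀ j ∈ J, ∀ g : G j, P x → P (x * ofVertex 𝒢 G j g))
    {x : GraphProduct 𝒢 G} (hx : x ∈ subgroupOf 𝒢 G J) : P x := by
  have := subgroupOf_induction_left (P := fun y => P y⁻¹) (by simpa using one)
    (fun j hj g y hy ih => by
      simpa using mul _ (inv_mem hy) j hj g⁻¹ ih) (inv_mem hx)
  simpa using this

theorem induction_left {P : GraphProduct 𝒢 G → Prop} (one : P 1)
    (mul : ∀ j, ∀ g : G j, ∀ x, P x → P (ofVertex 𝒢 G j g * x)) (x : GraphProduct 𝒢 G) : P x :=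
  subgroupOf_induction_left (J := Set.univ) one (fun j _ g x _ => mul j g x)
    (by rw [subgroupOf_univ]; trivial)

open Classical in
/-- The retraction of the graph product onto `Γ_J`, as an endomorphism. -/
noncomputable def retract (J : Set I) : GraphProduct 𝒢 G →* GraphProduct 𝒢 G :=
  lift (fun i => if i ∈ J then ofVertex 𝒢 G i else 1) (by
    intro i j hij g h
    by_cases hi : i ∈ J <;> by_cases hj : j ∈ J <;> simp [hi, hj, ofVertex_commute hij])

theorem retract_of_mem {J : Set I} {i : I} (hi : i ∈ J) (g : G i) :
    retract J (ofVertex 𝒢 G i g) = ofVertex 𝒢 G i g := by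
  simp [retract, hi]

theorem retract_of_notMem {J : Set I} {i : I} (hi : i ∉ J) (g : G i) :
    retract J (ofVertex 𝒢 G i g) = 1 := by
  simp [retract, hi]

/-- The retraction onto `Γ_J` fixes `Γ_J` pointwise and kills `G i`. Concluding only in `Γ` avoids
injectivity of `G i → Γ`. -/
theorem ofVertex_eq_one_of_mem_subgroupOf {J : Set I} {i : I} (hi : i ∉ J) {g : G i}
    (hg : ofVertex 𝒢 G i g ∈ subgroupOf 𝒢 G J) : ofVertex 𝒢 G i g = 1 := by
  have h1 : subgroupOf 𝒢 G J ≤ (retract (𝒢 := 𝒢) (G := G) J).eqLocus (MonoidHom.id _) :=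
    subgroupOf_le_iff.2 fun j hj h => retract_of_mem hj h
  have h2 : retract J (ofVertex 𝒢 G i g) = ofVertex 𝒢 G i g := h1 hg
  rw [← h2, retract_of_notMem hi]

theorem vtx_eq_iff {γ γ' : GraphProduct 𝒢 G} {J J' : Spherical 𝒢} :
    vtx 𝒢 G γ J = vtx 𝒢 G γ' J' ↔ J = J' ∧ γ⁻¹ * γ' ∈ subgroupOf 𝒢 G (J.1 : Set I) :=
  Quotient.eq (r := vertexSetoid 𝒢 G)

theorem vtx_mul {γ h : GraphProduct 𝒢 G} {J : Spherical 𝒢}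
    (hh : h ∈ subgroupOf 𝒢 G (J.1 : Set I)) : vtx 𝒢 G (γ * h) J = vtx 𝒢 G γ J :=
  (vtx_eq_iff.2 ⟨rfl, by simpa using hh⟩).symm

theorem exists_eq_vtx (w : Vertex 𝒢 G) : ∃ γ J, w = vtx 𝒢 G γ J := by
  obtain ⟨⟨γ, J⟩, rfl⟩ := Quotient.exists_rep w
  exact ⟨γ, J, rfl⟩

@[simp]
theorem stdType_vtx (γ : GraphProduct 𝒢 G) (J : Spherical 𝒢) :
    stdType 𝒢 G (vtx 𝒢 G γ J) = J := rfl

@[simp]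
theorem rk_vtx (γ : GraphProduct 𝒢 G) (J : Spherical 𝒢) :
    rk 𝒢 G (vtx 𝒢 G γ J) = J.1.card := rfl

theorem vtx_mem_chamber (γ : GraphProduct 𝒢 G) (J : Spherical 𝒢) :
    vtx 𝒢 G γ J ∈ chamber 𝒢 G γ := Set.mem_range_self _

theorem vtx_injective (γ : GraphProduct 𝒢 G) : Function.Injective (vtx 𝒢 G γ) :=
  fun _ _ h => (vtx_eq_iff.1 h).1

theorem vtx_empty_inj {γ γ' : GraphProduct 𝒢 G}
    (h : vtx 𝒢 G γ (Spherical.empty 𝒢) = vtx 𝒢 G γ' (Spherical.empty 𝒢)) : γ = γ' := by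
  have := (vtx_eq_iff.1 h).2
  simp only [Spherical.empty, Finset.coe_empty, subgroupOf_empty, Subgroup.mem_bot] at this
  exact inv_mul_eq_one.1 this

theorem vtx_empty_mem_chamber {γ γ' : GraphProduct 𝒢 G}
    (h : vtx 𝒢 G γ (Spherical.empty 𝒢) ∈ chamber 𝒢 G γ') : γ = γ' := by
  obtain ⟨J, hJ⟩ := h
  obtain rfl := (vtx_eq_iff.1 hJ).1
  exact (vtx_empty_inj hJ).symm

theorem chamber_injective : Function.Injective (chamber 𝒢 G) := fun γ _ h =>
  vtx_empty_mem_chamber (h ▸ vtx_mem_chamber γ _)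

theorem vtx_mem_chamber_iff {γ γ' : GraphProduct 𝒢 G} {J : Spherical 𝒢} :
    vtx 𝒢 G γ J ∈ chamber 𝒢 G γ' ↔ γ⁻¹ * γ' ∈ subgroupOf 𝒢 G (J.1 : Set I) := by
  constructor
  · rintro ⟨K, hK⟩
    obtain ⟨rfl, h⟩ := vtx_eq_iff.1 hK
    simpa using inv_mem h
  · intro h
    exact ⟨J, (vtx_eq_iff.2 ⟨rfl, h⟩).symm⟩

variable (𝒢) in
/-- The spherical subset with one element. -/
def Spherical.single (i : I) : Spherical 𝒢 := ⟨{i}, by simp⟩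

@[simp]
theorem Spherical.single_val (i : I) : (Spherical.single 𝒢 i).1 = {i} := rfl

theorem Spherical.single_injective : Function.Injective (Spherical.single 𝒢) := fun i j h => by
  simpa [Spherical.single] using h

theorem Spherical.single_le_iff {i : I} {J : Spherical 𝒢} :
    Spherical.single 𝒢 i ≤ J ↔ i ∈ J.1 := by
  change ({i} : Finset I) ⊆ J.1 ↔ _
  simp

open Classical in
/-- The spherical subset given by two adjacent vertices. -/
noncomputable def Spherical.pair {i j : I} (h : 𝒢.Adj i j) : Spherical 𝒢 :=
  ⟨{i, j}, by simp [SimpleGraph.isClique_insert, h]⟩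

end GraphProductBasics

/-! ### Cubical isomorphisms of chambers and typing maps. -/

section CubicalIso

variable {I : Type u} {𝒢 : SimpleGraph I} {G : I → Type v} [∀ i, Group (G i)]

theorem IsCubicalIso.symm {S T : Set (Vertex 𝒢 G)} {f : S ≃ T} (hf : IsCubicalIso f) :
    IsCubicalIso f.symm := fun n Q => by
  rw [hf n (f.symm '' Q), Equiv.image_symm_image]

theorem IsCubicalIso.trans {S T U : Set (Vertex 𝒢 G)} {f : S ≃ T} {g : T ≃ U}
    (hf : IsCubicalIso f) (hg : IsCubicalIso g) : IsCubicalIso (f.trans g) := fun n Q => by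
  rw [hf n Q, hg n (f '' Q), Equiv.coe_trans, Set.image_comp]

/-- The spherical subsets as vertices of a chamber. -/
noncomputable def chamberEquiv (γ : GraphProduct 𝒢 G) : Spherical 𝒢 ≃ chamber 𝒢 G γ :=
  Equiv.ofInjective _ (vtx_injective γ)

theorem isCube_lower (γ : GraphProduct 𝒢 G) (J : Spherical 𝒢) :
    IsCube 𝒢 G J.1.card {w | ∃ K ≤ J, w = vtx 𝒢 G γ K} := by
  refine ⟨γ, Spherical.empty 𝒢, J, by simp [Spherical.empty], by simp [Spherical.empty], ?_⟩
  ext w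
  simp only [Spherical.empty, Finset.empty_subset, true_and, Set.mem_ofPred_eq]
  rfl

/-- The center lies in a single chamber and its type is empty, which forces the cube into that
chamber with smallest type `∅`. -/
theorem IsCube.eq_lower {γ : GraphProduct 𝒢 G} {n : ℕ} {Q : Set (Vertex 𝒢 G)}
    (hQ : IsCube 𝒢 G n Q) (hc : vtx 𝒢 G γ (Spherical.empty 𝒢) ∈ Q) :
    ∃ J : Spherical 𝒢, J.1.card = n ∧ Q = {w | ∃ K ≤ J, w = vtx 𝒢 G γ K} := by
  obtain ⟨γ', J₁, J₂, h12, hcard, rfl⟩ := hQ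
  obtain ⟨J, h1, h2, hJ⟩ := hc
  obtain rfl := (vtx_eq_iff.1 hJ).1
  obtain rfl := vtx_empty_inj hJ
  have h0 : J₁.1 = ∅ := Finset.subset_empty.1 h1
  refine ⟨J₂, by simp [hcard, h0], ?_⟩
  ext w
  simp only [h0, Finset.empty_subset, true_and, Set.mem_ofPred_eq]
  rfl

/-- A bijection of spherical subsets that takes lower intervals to lower intervals of the same
rank is an isomorphism of posets. -/
theorem card_eq_and_le_iff_of_lower (e : Spherical 𝒢 ≃ Spherical 𝒢)
    (h : ∀ J, ∃ J' : Spherical 𝒢, J'.1.card = J.1.card ∧ ∀ K, K ≤ J ↔ e K ≤ J') (J : Spherical 𝒢) :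
    (e J).1.card = J.1.card ∧ ∀ K, e K ≤ e J ↔ K ≤ J := by
  obtain ⟨J', hc, hJ'⟩ := h J
  obtain ⟨J₃, rfl⟩ := e.surjective J'
  obtain ⟨J₃', hc₃, hJ₃⟩ := h J₃
  -- With `J₃` the preimage of the top `J'`, one has `|J| = |e J₃| ≤ |J₃'| = |J₃|`, so `J₃ ≤ J` is
  -- an equality.
  have hle : J₃ ≤ J := (hJ' J₃).2 le_rfl
  have h3 : e J₃ ≤ J₃' := (hJ₃ J₃).1 le_rfl
  have hc' : (e J₃).1.card ≤ J₃'.1.card := Finset.card_le_card h3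
  obtain rfl : J₃ = J := Subtype.ext (Finset.eq_of_subset_of_card_le hle (by omega))
  exact ⟨hc, fun K => (hJ' K).symm⟩

/-- A center-preserving cubical isomorphism of chambers is given by an automorphism of the poset
of spherical subsets. -/
theorem IsCubicalIso.exists_orderIso {γ γ' : GraphProduct 𝒢 G}
    {f : chamber 𝒢 G γ ≃ chamber 𝒢 G γ'} (hf : IsCubicalIso f)
    (hc : f (center 𝒢 G γ) = center 𝒢 G γ') :
    ∃ e : Spherical 𝒢 ≃o Spherical 𝒢, (∀ J, f (chamberEquiv γ J) = chamberEquiv γ' (e J)) ∧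
      ∀ J, (e J).1.card = J.1.card := by
  let e := ((chamberEquiv γ).trans f).trans (chamberEquiv γ').symm
  have he : ∀ J, f (chamberEquiv γ J) = chamberEquiv γ' (e J) := fun J => by simp [e]
  have key := card_eq_and_le_iff_of_lower e fun J => by
    -- The lower interval of `J` spans a cube through the center; its image is a cube through the
    -- center of the target, hence again a lower interval.
    have hQ : Subtype.val '' (chamberEquiv γ '' Set.Iic J) = {w | ∃ K ≤ J, w = vtx 𝒢 G γ K} := by
      ext w
      constructor
      · rintro ⟨_, ⟨K, hK, rfl⟩, rfl⟩
        exact ⟨K, hK, rfl⟩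
      · rintro ⟨K, hK, rfl⟩
        exact ⟨_, ⟨K, hK, rfl⟩, rfl⟩
    have h1 := (hf J.1.card (chamberEquiv γ '' Set.Iic J)).1 (by rw [hQ]; exact isCube_lower γ J)
    obtain ⟨J', hJ', hE⟩ := h1.eq_lower (γ := γ')
      ⟨f (center 𝒢 G γ), ⟨_, ⟨Spherical.empty 𝒢, Finset.empty_subset _, rfl⟩, rfl⟩, by
        rw [hc]; rfl⟩
    refine ⟨J', hJ', fun K => ?_⟩
    have h2 : (chamberEquiv γ' (e K) : Vertex 𝒢 G) ∈
        Subtype.val '' (f '' (chamberEquiv γ '' Set.Iic J)) ↔ K ≤ J := by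
      rw [← he, Subtype.val_injective.mem_set_image, f.injective.mem_set_image,
        (chamberEquiv γ).injective.mem_set_image]
      rfl
    rw [← h2, hE]
    constructor
    · rintro ⟨L, hL, h⟩
      rwa [vtx_injective _ h]
    · exact fun h => ⟨_, h, rfl⟩
  exact ⟨⟨e, fun {K J} => (key J).2 K⟩, he, fun J => (key J).1⟩

variable {t : Vertex 𝒢 G → Spherical 𝒢}

theorem IsTypingMap.exists_orderIso (ht : IsTypingMap 𝒢 G t) (γ : GraphProduct 𝒢 G) :
    ∃ e : Spherical 𝒢 ≃o Spherical 𝒢, (∀ J, t (vtx 𝒢 G γ J) = e J) ∧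
      ∀ J, (e J).1.card = J.1.card := by
  obtain ⟨φ, hφ, hc, h⟩ := ht.exists_iso γ
  obtain ⟨e, he, hcard⟩ := hφ.exists_orderIso hc
  refine ⟨e, fun J => ?_, hcard⟩
  have := h (chamberEquiv γ J)
  rw [he] at this
  exact this

/-- The automorphism of the poset of spherical subsets that takes the standard types of the
vertices of a chamber to their types under a typing map. -/
noncomputable def IsTypingMap.typeIso (ht : IsTypingMap 𝒢 G t) (γ : GraphProduct 𝒢 G) :
    Spherical 𝒢 ≃o Spherical 𝒢 := (ht.exists_orderIso γ).choose

theorem IsTypingMap.apply_vtx (ht : IsTypingMap 𝒢 G t) (γ : GraphProduct 𝒢 G) (J : Spherical 𝒢) :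
    t (vtx 𝒢 G γ J) = ht.typeIso γ J := (ht.exists_orderIso γ).choose_spec.1 J

theorem IsTypingMap.card_typeIso (ht : IsTypingMap 𝒢 G t) (γ : GraphProduct 𝒢 G)
    (J : Spherical 𝒢) : (ht.typeIso γ J).1.card = J.1.card :=
  (ht.exists_orderIso γ).choose_spec.2 J

theorem IsTypingMap.card_typeIso_symm (ht : IsTypingMap 𝒢 G t) (γ : GraphProduct 𝒢 G)
    (J : Spherical 𝒢) : ((ht.typeIso γ).symm J).1.card = J.1.card := by
  rw [← ht.card_typeIso γ, OrderIso.apply_symm_apply]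

theorem IsTypingMap.card_apply (ht : IsTypingMap 𝒢 G t) (w : Vertex 𝒢 G) :
    (t w).1.card = rk 𝒢 G w := by
  obtain ⟨γ, J, rfl⟩ := exists_eq_vtx w
  rw [ht.apply_vtx, ht.card_typeIso, rk_vtx]

/-- The vertex of a given type of a chamber. -/
noncomputable def IsTypingMap.vert (ht : IsTypingMap 𝒢 G t) (γ : GraphProduct 𝒢 G)
    (J : Spherical 𝒢) : Vertex 𝒢 G := vtx 𝒢 G γ ((ht.typeIso γ).symm J)

theorem IsTypingMap.apply_vert (ht : IsTypingMap 𝒢 G t) (γ : GraphProduct 𝒢 G)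
    (J : Spherical 𝒢) : t (ht.vert γ J) = J := by
  rw [vert, ht.apply_vtx, OrderIso.apply_symm_apply]

theorem IsTypingMap.vert_mem_chamber (ht : IsTypingMap 𝒢 G t) (γ : GraphProduct 𝒢 G)
    (J : Spherical 𝒢) : ht.vert γ J ∈ chamber 𝒢 G γ := vtx_mem_chamber _ _

theorem IsTypingMap.eq_vert (ht : IsTypingMap 𝒢 G t) {γ : GraphProduct 𝒢 G} {w : Vertex 𝒢 G}
    (hw : w ∈ chamber 𝒢 G γ) : w = ht.vert γ (t w) := by
  obtain ⟨J, rfl⟩ := hw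
  rw [vert, ht.apply_vtx, OrderIso.symm_apply_apply]

theorem IsTypingMap.typeIso_eq_iff (ht : IsTypingMap 𝒢 G t) {γ : GraphProduct 𝒢 G}
    {J K : Spherical 𝒢} : ht.typeIso γ J = K ↔ t (vtx 𝒢 G γ J) = K := by rw [ht.apply_vtx]

theorem IsTypingMap.exists_single (ht : IsTypingMap 𝒢 G t) (γ : GraphProduct 𝒢 G) (i : I) :
    ∃ j, (ht.typeIso γ).symm (Spherical.single 𝒢 i) = Spherical.single 𝒢 j := by
  have h := ht.card_typeIso_symm γ (Spherical.single 𝒢 i)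
  rw [Spherical.single_val, Finset.card_singleton, Finset.card_eq_one] at h
  obtain ⟨j, hj⟩ := h
  exact ⟨j, Subtype.ext hj⟩

/-- The standard type of the vertex of type `{i}` of a chamber. -/
noncomputable def IsTypingMap.std (ht : IsTypingMap 𝒢 G t) (γ : GraphProduct 𝒢 G) (i : I) : I :=
  (ht.exists_single γ i).choose

theorem IsTypingMap.vert_single (ht : IsTypingMap 𝒢 G t) (γ : GraphProduct 𝒢 G) (i : I) :
    ht.vert γ (Spherical.single 𝒢 i) = vtx 𝒢 G γ (Spherical.single 𝒢 (ht.std γ i)) := by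
  rw [vert, (ht.exists_single γ i).choose_spec, std]

theorem IsTypingMap.typeIso_single (ht : IsTypingMap 𝒢 G t) (γ : GraphProduct 𝒢 G) (i : I) :
    ht.typeIso γ (Spherical.single 𝒢 (ht.std γ i)) = Spherical.single 𝒢 i := by
  rw [ht.typeIso_eq_iff, ← ht.vert_single, ht.apply_vert]

theorem IsTypingMap.std_eq_iff (ht : IsTypingMap 𝒢 G t) {γ : GraphProduct 𝒢 G} {i j : I} :
    ht.std γ i = j ↔ (t (vtx 𝒢 G γ (Spherical.single 𝒢 j))).1 = {i} := by
  rw [ht.apply_vtx]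
  constructor
  · rintro rfl
    rw [ht.typeIso_single, Spherical.single_val]
  · intro h
    have h' : ht.typeIso γ (Spherical.single 𝒢 j) = Spherical.single 𝒢 i := Subtype.ext h
    rw [← ht.typeIso_single γ i] at h'
    exact (Spherical.single_injective ((ht.typeIso γ).injective h')).symm

theorem IsTypingMap.std_surjective (ht : IsTypingMap 𝒢 G t) (γ : GraphProduct 𝒢 G) (j : I) :
    ∃ i, ht.std γ i = j := by
  have h := ht.card_typeIso γ (Spherical.single 𝒢 j)
  rw [Spherical.single_val, Finset.card_singleton, Finset.card_eq_one] at h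
  obtain ⟨i, hi⟩ := h
  exact ⟨i, ht.std_eq_iff.2 (by rw [ht.apply_vtx, hi])⟩

theorem IsTypingMap.std_injective (ht : IsTypingMap 𝒢 G t) (γ : GraphProduct 𝒢 G) :
    Function.Injective (ht.std γ) := fun i i' h => by
  have h1 := ht.typeIso_single γ i
  rw [h, ht.typeIso_single] at h1
  exact (Spherical.single_injective h1).symm

theorem IsTypingMap.std_mem_iff (ht : IsTypingMap 𝒢 G t) {γ : GraphProduct 𝒢 G} {i : I}
    {J : Spherical 𝒢} : ht.std γ i ∈ J.1 ↔ i ∈ (ht.typeIso γ J).1 := by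
  rw [← Spherical.single_le_iff, ← (ht.typeIso γ).le_iff_le, ht.typeIso_single,
    Spherical.single_le_iff]

/-- An edge is a spherical pair, and its preimage under the poset automorphism is spherical and
contains both standard types. -/
theorem IsTypingMap.adj_std (ht : IsTypingMap 𝒢 G t) (γ : GraphProduct 𝒢 G) {i i' : I}
    (h : 𝒢.Adj i i') : 𝒢.Adj (ht.std γ i) (ht.std γ i') := by
  have hmem : ∀ k ∈ (Spherical.pair h).1,
      ht.std γ k ∈ ((ht.typeIso γ).symm (Spherical.pair h)).1 := fun k hk => by
    rwa [ht.std_mem_iff, OrderIso.apply_symm_apply]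
  exact ((ht.typeIso γ).symm (Spherical.pair h)).2 (hmem i (by simp [Spherical.pair]))
    (hmem i' (by simp [Spherical.pair])) fun h' => h.ne (ht.std_injective γ h')

theorem IsTypingMap.adj_of_adj_std (ht : IsTypingMap 𝒢 G t) {γ : GraphProduct 𝒢 G} {i i' : I}
    (h : 𝒢.Adj (ht.std γ i) (ht.std γ i')) : 𝒢.Adj i i' := by
  have hmem : ∀ k, ht.std γ k ∈ (Spherical.pair h).1 →
      k ∈ (ht.typeIso γ (Spherical.pair h)).1 := fun k hk => ht.std_mem_iff.1 hk
  refine (ht.typeIso γ (Spherical.pair h)).2 (hmem i (by simp [Spherical.pair]))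
    (hmem i' (by simp [Spherical.pair])) ?_
  rintro rfl
  exact h.ne rfl

theorem IsTypingMap.std_mul_of_eq (ht : IsTypingMap 𝒢 G t) {γ : GraphProduct 𝒢 G} {i : I}
    (h : G (ht.std γ i)) : ht.std (γ * ofVertex 𝒢 G _ h) i = ht.std γ i := by
  rw [ht.std_eq_iff, vtx_mul (ofVertex_mem_subgroupOf (by simp) h), ← ht.std_eq_iff]

/-- The two chambers share the vertices of standard types `{std γ i, k}` and `{k}`, so the types of
these agree; what remains of the pair must have type `{i}` in both chambers. -/
theorem IsTypingMap.std_mul_of_adj (ht : IsTypingMap 𝒢 G t) {γ : GraphProduct 𝒢 G} {i k : I}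
    (hk : 𝒢.Adj (ht.std γ i) k) (h : G k) :
    ht.std (γ * ofVertex 𝒢 G k h) i = ht.std γ i := by
  obtain ⟨i', rfl⟩ := ht.std_surjective γ k
  have h1 : ht.typeIso (γ * ofVertex 𝒢 G _ h) (Spherical.pair hk) =
      ht.typeIso γ (Spherical.pair hk) := by
    rw [ht.typeIso_eq_iff, vtx_mul (ofVertex_mem_subgroupOf (by simp [Spherical.pair]) h),
      ht.apply_vtx]
  have h2 : i ∈ (ht.typeIso γ (Spherical.pair hk)).1 := by
    rw [← ht.std_mem_iff]; simp [Spherical.pair]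
  rw [← h1, ← ht.std_mem_iff] at h2
  simp only [Spherical.pair, Finset.mem_insert, Finset.mem_singleton] at h2
  refine h2.resolve_right fun h3 => ?_
  have h3 := h3.trans (ht.std_mul_of_eq h).symm
  have := ht.std_injective _ h3
  subst this
  exact hk.ne rfl

end CubicalIso

/-! ### Level-equivalence of rank-1 vertices. -/

section Level

variable {I : Type u} {𝒢 : SimpleGraph I} {G : I → Type v} [∀ i, Group (G i)]

theorem LevelAdj.rk_eq {x y : Vertex 𝒢 G} (h : LevelAdj 𝒢 G x y) : rk 𝒢 G x = rk 𝒢 G y := by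
  obtain ⟨-, -, -, -, -, -, -, z, -, -, -, h1, h2⟩ := h
  omega

theorem Spherical.eq_single_of_subset_of_card {J K : Spherical 𝒢} {k : I} (hJK : J.1 ⊆ K.1)
    (hk : k ∈ K.1) (hJ : k ∉ J.1) (hK : K.1.card = 2) (hJ1 : J.1.card = 1) {j : I} (hj : j ∈ K.1)
    (hjk : j ≠ k) : J = Spherical.single 𝒢 j := by
  classical
  obtain ⟨l, hl⟩ := Finset.card_eq_one.1 hJ1
  refine Subtype.ext (hl.trans (congrArg _ ?_))
  obtain ⟨a, b, -, hab⟩ := Finset.card_eq_two.1 hK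
  have hlJ : l ∈ J.1 := by simp [hl]
  have hlk : l ≠ k := fun h => hJ (h ▸ hlJ)
  have hlK := hJK hlJ
  rw [hab] at hk hj hlK
  simp only [Finset.mem_insert, Finset.mem_singleton] at hk hj hlK
  grind

/-- The common upper vertex has a type `{j, k}` with `k` the adjacency label, as otherwise the
chambers coincide. A vertex whose type contains `k` would lie in both chambers, so both rank-1 types
are `{j}`. -/
theorem LevelAdj.exists_of_rk_eq_one {x y : Vertex 𝒢 G} (h : LevelAdj 𝒢 G x y)
    (hx : rk 𝒢 G x = 1) : ∃ (γ : GraphProduct 𝒢 G) (j k : I) (h : G k), 𝒢.Adj j k ∧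
      x = vtx 𝒢 G γ (Spherical.single 𝒢 j) ∧
      y = vtx 𝒢 G (γ * ofVertex 𝒢 G k h) (Spherical.single 𝒢 j) := by
  have hy : rk 𝒢 G y = 1 := h.rk_eq ▸ hx
  obtain ⟨_, _, ⟨k, γ, γ', rfl, rfl, hne, ⟨h, hh⟩⟩, ⟨J, rfl⟩, ⟨J', rfl⟩, hxC, hyC,
    z, ⟨⟨K, rfl⟩, hz⟩, hxz, hyz, hrk, -⟩ := h
  obtain rfl : γ' = γ * ofVertex 𝒢 G k h := by rw [hh]; group
  rw [inv_mul_cancel_left] at hne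
  rw [vtx_mem_chamber_iff, inv_mul_cancel_left] at hz
  have hk : k ∈ K.1 := by
    by_contra hk
    exact hne (ofVertex_eq_one_of_mem_subgroupOf (by simpa using hk) hz)
  have hJ : k ∉ J.1 := fun hk => hxC ⟨vtx_mem_chamber _ _, by
    rw [vtx_mem_chamber_iff, inv_mul_cancel_left]
    exact ofVertex_mem_subgroupOf (by simpa using hk) h⟩
  have hJ' : k ∉ J'.1 := fun hk => hyC ⟨by
    rw [vtx_mul (ofVertex_mem_subgroupOf (by simpa using hk) h)]
    exact vtx_mem_chamber _ _, vtx_mem_chamber _ _⟩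
  rw [rk_vtx] at hx hy
  rw [rk_vtx, rk_vtx, hx] at hrk
  obtain ⟨j, hj⟩ := Finset.card_eq_one.1 hx
  have hjJ : j ∈ J.1 := by simp [hj]
  have hjK : j ∈ K.1 := hxz.1 hjJ
  have hjk : j ≠ k := fun e => hJ (e ▸ hjJ)
  refine ⟨γ, j, k, h, K.2 (by simpa using hjK) (by simpa using hk) hjk, ?_, ?_⟩
  · exact congrArg _ (Spherical.eq_single_of_subset_of_card hxz.1 hk hJ hrk hx hjK hjk)
  · exact congrArg _ (Spherical.eq_single_of_subset_of_card hyz.1 hk hJ' hrk hy hjK hjk)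

/-- Induction on level-equivalence of vertices of rank one. -/
theorem rel_of_levelClass_eq {r : Vertex 𝒢 G → Vertex 𝒢 G → Prop} (hr : Equivalence r)
    (hstep : ∀ (γ : GraphProduct 𝒢 G) (j k : I) (h : G k), 𝒢.Adj j k →
      r (vtx 𝒢 G γ (Spherical.single 𝒢 j))
        (vtx 𝒢 G (γ * ofVertex 𝒢 G k h) (Spherical.single 𝒢 j)))
    {x y : Vertex 𝒢 G} (hxy : levelClass x = levelClass y) (hx : rk 𝒢 G x = 1) : r x y := by
  have h : Relation.EqvGen (LevelAdj 𝒢 G) x y := Quotient.exact hxy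
  suffices rk 𝒢 G x = rk 𝒢 G y ∧ (rk 𝒢 G x = 1 → r x y) from this.2 hx
  clear hx hxy
  induction h with
  | rel x y h =>
    refine ⟨h.rk_eq, fun hx => ?_⟩
    obtain ⟨γ, j, k, g, hjk, rfl, rfl⟩ := h.exists_of_rk_eq_one hx
    exact hstep γ j k g hjk
  | refl x => exact ⟨rfl, fun _ => hr.refl x⟩
  | symm x y _ ih => exact ⟨ih.1.symm, fun h => hr.symm (ih.2 (ih.1.trans h))⟩
  | trans x y z _ _ ih1 ih2 =>
    exact ⟨ih1.1.trans ih2.1, fun h => hr.trans (ih1.2 h) (ih2.2 (ih1.1.symm.trans h))⟩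

/-- The vertex of type `{j, k}` shared by the two chambers witnesses level-adjacency, unless `h` is
trivial in `Γ` and the vertices coincide. -/
theorem levelClass_mul_ofVertex (γ : GraphProduct 𝒢 G) {j k : I} (hjk : 𝒢.Adj j k) (h : G k) :
    levelClass (vtx 𝒢 G (γ * ofVertex 𝒢 G k h) (Spherical.single 𝒢 j)) =
      levelClass (vtx 𝒢 G γ (Spherical.single 𝒢 j)) := by
  by_cases h1 : ofVertex 𝒢 G k h = 1
  · rw [h1, mul_one]
  have hnot : ofVertex 𝒢 G k h ∉ subgroupOf 𝒢 G ((Spherical.single 𝒢 j).1 : Set I) := fun hm =>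
    h1 (ofVertex_eq_one_of_mem_subgroupOf (by simpa using hjk.ne') hm)
  have hk : ofVertex 𝒢 G k h ∈ subgroupOf 𝒢 G ((Spherical.pair hjk).1 : Set I) :=
    ofVertex_mem_subgroupOf (by simp [Spherical.pair]) h
  have hz := vtx_mul (γ := γ) hk
  refine (Quotient.sound (Relation.EqvGen.rel _ _ ?_)).symm
  refine ⟨_, _, ⟨k, γ, γ * ofVertex 𝒢 G k h, rfl, rfl, by simpa using h1, ⟨h, by simp⟩⟩,
    vtx_mem_chamber _ _, vtx_mem_chamber _ _, ?_, ?_, vtx 𝒢 G γ (Spherical.pair hjk),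
    ⟨vtx_mem_chamber _ _, hz ▸ vtx_mem_chamber _ _⟩,
    ⟨by simp [Spherical.pair], _, ⟨γ, rfl⟩, vtx_mem_chamber _ _, vtx_mem_chamber _ _⟩,
    ⟨by simp [Spherical.pair], _, ⟨γ * ofVertex 𝒢 G k h, rfl⟩, vtx_mem_chamber _ _,
      hz ▸ vtx_mem_chamber _ _⟩, ?_, ?_⟩
  · rintro ⟨-, hm⟩
    rw [vtx_mem_chamber_iff, inv_mul_cancel_left] at hm
    exact hnot hm
  · rintro ⟨hm, -⟩
    rw [vtx_mem_chamber_iff, mul_inv_rev, inv_mul_cancel_right] at hm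
    exact hnot (by simpa using hm)
  · simp [Spherical.pair, hjk.ne]
  · simp [Spherical.pair, hjk.ne]

theorem levelClass_mul (γ : GraphProduct 𝒢 G) {j : I} {y : GraphProduct 𝒢 G}
    (hy : y ∈ subgroupOf 𝒢 G (𝒢.neighborSet j)) :
    levelClass (vtx 𝒢 G (γ * y) (Spherical.single 𝒢 j)) =
      levelClass (vtx 𝒢 G γ (Spherical.single 𝒢 j)) := by
  refine subgroupOf_induction_right (P := fun y =>
    levelClass (vtx 𝒢 G (γ * y) (Spherical.single 𝒢 j)) =
      levelClass (vtx 𝒢 G γ (Spherical.single 𝒢 j))) (by rw [mul_one]) ?_ hy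
  intro x _ k hk h ih
  rw [← mul_assoc, levelClass_mul_ofVertex _ hk, ih]

theorem mem_chambersOf (γ : GraphProduct 𝒢 G) (J : Spherical 𝒢) :
    chamber 𝒢 G γ ∈ chambersOf (levelClass (vtx 𝒢 G γ J)) :=
  ⟨⟨γ, rfl⟩, _, vtx_mem_chamber _ _, rfl⟩

theorem mul_mem_chambersOf (γ : GraphProduct 𝒢 G) {j : I} {y : GraphProduct 𝒢 G}
    (hy : y ∈ subgroupOf 𝒢 G (𝒢.neighborSet j)) :
    chamber 𝒢 G (γ * y) ∈ chambersOf (levelClass (vtx 𝒢 G γ (Spherical.single 𝒢 j))) :=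
  ⟨⟨_, rfl⟩, _, vtx_mem_chamber _ _, levelClass_mul γ hy⟩

theorem IsTypingMap.eq_of_levelClass_eq {t : Vertex 𝒢 G → Spherical 𝒢} (ht : IsTypingMap 𝒢 G t)
    {x y : Vertex 𝒢 G} (hxy : levelClass x = levelClass y) (hx : rk 𝒢 G x = 1) : t x = t y := by
  refine rel_of_levelClass_eq (r := fun x y => t x = t y)
    ⟨fun _ => rfl, fun h => h.symm, fun h h' => h.trans h'⟩ (fun γ j k h hjk => ?_) hxy hx
  obtain ⟨i, rfl⟩ := ht.std_surjective γ j
  have h1 := ht.std_mul_of_adj hjk h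
  refine Subtype.ext ?_
  rw [ht.std_eq_iff.1 h1, ht.std_eq_iff.1 rfl]

theorem mul_ofVertex_mem_residue (γ : GraphProduct 𝒢 G) {J : Set I} {y : GraphProduct 𝒢 G}
    (hy : y ∈ subgroupOf 𝒢 G J) : chamber 𝒢 G (γ * y) ∈ residue 𝒢 G J (chamber 𝒢 G γ) := by
  refine subgroupOf_induction_right (P := fun y =>
    chamber 𝒢 G (γ * y) ∈ residue 𝒢 G J (chamber 𝒢 G γ))
    (by rw [mul_one]; exact Relation.ReflTransGen.refl) ?_ hy
  intro x _ j hj h ih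
  rw [← mul_assoc]
  -- Adjacent chambers are distinct by definition, so a trivial factor contributes no step to the
  -- gallery.
  by_cases h1 : ofVertex 𝒢 G j h = 1
  · rwa [h1, mul_one]
  · exact ih.tail ⟨j, hj, _, _, rfl, rfl, by rwa [inv_mul_cancel_left],
      ⟨h, by rw [inv_mul_cancel_left]⟩⟩

end Level

/-! ### The action of the graph product on chambers. -/

namespace TypedAtlas

variable {I : Type u} {𝒢 : SimpleGraph I} {G : I → Type v} [∀ i, Group (G i)]
  (𝔸 : TypedAtlas 𝒢 G)

theorem atlas_congr {c c' : LevelClass 𝒢 G} (hc : c = c') {i : I}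
    (h : ∃ w, levelClass w = c ∧ (𝔸.t w).1 = {i}) (h' : ∃ w, levelClass w = c' ∧ (𝔸.t w).1 = {i})
    (g : G i) (C : chambersOf c) (C' : chambersOf c') (hC : (C : Set (Vertex 𝒢 G)) = C') :
    (𝔸.atlas c i h g C : Set (Vertex 𝒢 G)) = 𝔸.atlas c' i h' g C' := by
  subst hc
  rw [Subtype.ext hC]

/-- Preservation of the product makes the displacement `η g` independent of `y` in the second
factor; simple transitivity on the first factor gives the unique `g` for each `h`. -/
theorem exists_step (γ : GraphProduct 𝒢 G) (i j : I)
    (hi : (𝔸.t (vtx 𝒢 G γ (Spherical.single 𝒢 j))).1 = {i}) :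
    ∃ η : G i → GraphProduct 𝒢 G, (∀ g, ∃ h : G j, η g = ofVertex 𝒢 G j h) ∧
      (∀ h : G j, ∃! g, η g = ofVertex 𝒢 G j h) ∧
      ∀ (g : G i), ∀ y ∈ subgroupOf 𝒢 G (𝒢.neighborSet j), ∀ hD,
        (𝔸.atlas (levelClass (vtx 𝒢 G γ (Spherical.single 𝒢 j))) i ⟨_, rfl, hi⟩ g
          ⟨chamber 𝒢 G (γ * y), hD⟩ : Set (Vertex 𝒢 G)) = chamber 𝒢 G (γ * η g * y) := by
  obtain ⟨ρ, hρ, hprod⟩ := 𝔸.product_action _ i j hi rfl (chamber 𝒢 G γ) ⟨γ, rfl⟩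
    (vtx_mem_chamber _ _)
  let C₀ : residue 𝒢 G {j} (chamber 𝒢 G γ) := ⟨chamber 𝒢 G γ, Relation.ReflTransGen.refl⟩
  have key : ∀ (g : G i), ∀ y ∈ subgroupOf 𝒢 G (𝒢.neighborSet j), ∀ hD, ∃ h : G j,
      (ρ g C₀ : Set (Vertex 𝒢 G)) = chamber 𝒢 G (γ * ofVertex 𝒢 G j h) ∧
      (𝔸.atlas (levelClass (vtx 𝒢 G γ (Spherical.single 𝒢 j))) i ⟨_, rfl, hi⟩ g
          ⟨chamber 𝒢 G (γ * y), hD⟩ : Set (Vertex 𝒢 G)) =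
            chamber 𝒢 G (γ * ofVertex 𝒢 G j h * y) := by
    intro g y hy hD
    obtain ⟨γ', γ₁, γ₂, h₁, -, hγ, e₁, e₂, e⟩ := hprod g C₀
      ⟨chamber 𝒢 G (γ * y), mul_ofVertex_mem_residue γ hy⟩ ⟨chamber 𝒢 G (γ * y), hD⟩
      -- Relative to the base `C_γ`, the chamber `C_{γy}` has coordinates `(C_γ, C_{γy})`.
      ⟨γ, 1, y, one_mem _, hy, rfl, by simp [C₀], rfl, by simp⟩
    obtain rfl := chamber_injective hγ
    obtain rfl := mul_left_cancel (chamber_injective e₂)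
    rw [subgroupOf_singleton] at h₁
    obtain ⟨h, rfl⟩ := h₁
    exact ⟨h, e₁, e⟩
  have hC : ∀ g, ∃ h : G j, (ρ g C₀ : Set (Vertex 𝒢 G)) = chamber 𝒢 G (γ * ofVertex 𝒢 G j h) :=
    fun g => by
      obtain ⟨h, hh, -⟩ := key g 1 (one_mem _) (mul_mem_chambersOf γ (one_mem _))
      exact ⟨h, hh⟩
  choose η hη using hC
  refine ⟨fun g => ofVertex 𝒢 G j (η g), fun g => ⟨η g, rfl⟩, fun h => ?_, fun g y hy hD => ?_⟩
  · have hres : chamber 𝒢 G (γ * ofVertex 𝒢 G j h) ∈ residue 𝒢 G {j} (chamber 𝒢 G γ) :=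
      mul_ofVertex_mem_residue γ (ofVertex_mem_subgroupOf (Set.mem_singleton j) h)
    obtain ⟨g, hg, huniq⟩ := hρ C₀ ⟨_, hres⟩
    refine ⟨g, ?_, fun g' hg' => huniq g' ?_⟩
    · have h1 := hη g
      rw [hg] at h1
      exact (mul_left_cancel (chamber_injective h1)).symm
    · exact Subtype.ext ((hη g').trans (congrArg (fun z => chamber 𝒢 G (γ * z)) hg'))
  · obtain ⟨h, hh, e⟩ := key g y hy hD
    rw [hη g] at hh
    rw [e, ← mul_left_cancel (chamber_injective hh)]

/-- The standard type of the vertex of type `{i}` of a chamber. -/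
noncomputable abbrev std (γ : GraphProduct 𝒢 G) (i : I) : I := 𝔸.isTypingMap.std γ i

theorem t_std (γ : GraphProduct 𝒢 G) (i : I) :
    (𝔸.t (vtx 𝒢 G γ (Spherical.single 𝒢 (𝔸.std γ i)))).1 = {i} :=
  𝔸.isTypingMap.std_eq_iff.1 rfl

/-- The element by which `g` moves the chamber `C_γ`. -/
noncomputable def step (i : I) (g : G i) (γ : GraphProduct 𝒢 G) : GraphProduct 𝒢 G :=
  (𝔸.exists_step γ i _ (𝔸.t_std γ i)).choose g

/-- The chamber to which `g` moves the chamber `C_γ`. -/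
noncomputable def move (i : I) (g : G i) (γ : GraphProduct 𝒢 G) : GraphProduct 𝒢 G :=
  γ * 𝔸.step i g γ

theorem exists_move_eq (i : I) (g : G i) (γ : GraphProduct 𝒢 G) :
    ∃ h : G (𝔸.std γ i), 𝔸.move i g γ = γ * ofVertex 𝒢 G _ h := by
  obtain ⟨h, hh⟩ := (𝔸.exists_step γ i _ (𝔸.t_std γ i)).choose_spec.1 g
  exact ⟨h, congrArg _ hh⟩

theorem existsUnique_move_eq (i : I) (γ : GraphProduct 𝒢 G) (h : G (𝔸.std γ i)) :
    ∃! g : G i, 𝔸.move i g γ = γ * ofVertex 𝒢 G _ h := by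
  simpa only [move, mul_right_inj] using! (𝔸.exists_step γ i _ (𝔸.t_std γ i)).choose_spec.2.1 h

theorem atlas_std (i : I) (g : G i) (γ : GraphProduct 𝒢 G) {y : GraphProduct 𝒢 G}
    (hy : y ∈ subgroupOf 𝒢 G (𝒢.neighborSet (𝔸.std γ i))) (hD) :
    (𝔸.atlas (levelClass (vtx 𝒢 G γ (Spherical.single 𝒢 (𝔸.std γ i)))) i ⟨_, rfl, 𝔸.t_std γ i⟩ g
      ⟨chamber 𝒢 G (γ * y), hD⟩ : Set (Vertex 𝒢 G)) = chamber 𝒢 G (𝔸.move i g γ * y) :=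
  (𝔸.exists_step γ i _ (𝔸.t_std γ i)).choose_spec.2.2 g y hy hD

theorem rk_eq_one {w : Vertex 𝒢 G} {i : I} (hi : (𝔸.t w).1 = {i}) : rk 𝒢 G w = 1 := by
  rw [← 𝔸.isTypingMap.card_apply, hi, Finset.card_singleton]

/-- Types are constant on a class of rank-1 vertices, and a chamber has only one vertex of each
type. -/
theorem levelClass_eq_of_mem_chambersOf {w : Vertex 𝒢 G} {i : I} (hi : (𝔸.t w).1 = {i})
    {γ : GraphProduct 𝒢 G} (hC : chamber 𝒢 G γ ∈ chambersOf (levelClass w)) :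
    levelClass w = levelClass (vtx 𝒢 G γ (Spherical.single 𝒢 (𝔸.std γ i))) := by
  obtain ⟨-, x, hx, hxw⟩ := hC
  have ht := 𝔸.isTypingMap.eq_of_levelClass_eq hxw.symm (𝔸.rk_eq_one hi)
  have hxt : 𝔸.t x = Spherical.single 𝒢 i := Subtype.ext (ht ▸ hi)
  rw [← hxw, 𝔸.isTypingMap.eq_vert hx, hxt, 𝔸.isTypingMap.vert_single]

/-- The atlas in terms of the moves of chambers. -/
theorem atlas_eq {w : Vertex 𝒢 G} {i : I} (hi : (𝔸.t w).1 = {i}) (g : G i)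
    (γ : GraphProduct 𝒢 G) (hC : chamber 𝒢 G γ ∈ chambersOf (levelClass w)) :
    (𝔸.atlas (levelClass w) i ⟨w, rfl, hi⟩ g ⟨_, hC⟩ : Set (Vertex 𝒢 G)) =
      chamber 𝒢 G (𝔸.move i g γ) := by
  rw [← mul_one (𝔸.move i g γ),
    ← 𝔸.atlas_std i g γ (one_mem _) (mul_mem_chambersOf γ (one_mem _))]
  exact 𝔸.atlas_congr (𝔸.levelClass_eq_of_mem_chambersOf hi hC) _ _ _ _ _ (congrArg (chamber 𝒢 G) (mul_one γ).symm)

/-- The atlas permutation is evaluated at `C_{γy}` in two ways: by coordinates based at `C_γ`, and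
directly as a move. -/
theorem move_mul (i : I) (g : G i) (γ : GraphProduct 𝒢 G) {y : GraphProduct 𝒢 G}
    (hy : y ∈ subgroupOf 𝒢 G (𝒢.neighborSet (𝔸.std γ i))) :
    𝔸.move i g (γ * y) = 𝔸.move i g γ * y := by
  refine chamber_injective ?_
  rw [← 𝔸.atlas_std i g γ hy (mul_mem_chambersOf γ hy), 𝔸.atlas_eq (𝔸.t_std γ i)]

/-- The action of a vertex group on chambers. -/
noncomputable def vertexAction (i : I) : G i →* Equiv.Perm (GraphProduct 𝒢 G) :=
  MonoidHom.toHomPerm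
    { toFun := fun g => 𝔸.move i g
      map_one' := by
        funext γ
        refine chamber_injective ?_
        rw [← 𝔸.atlas_eq (𝔸.t_std γ i) 1 γ (mem_chambersOf _ _), map_one]
        rfl
      map_mul' := fun g g' => by
        funext γ
        refine chamber_injective ?_
        change _ = chamber 𝒢 G (𝔸.move i g (𝔸.move i g' γ))
        have h' := 𝔸.atlas_eq (𝔸.t_std γ i) g' γ (mem_chambersOf _ _)
        have hC := h' ▸ Subtype.coe_prop (𝔸.atlas
          (levelClass (vtx 𝒢 G γ (Spherical.single 𝒢 (𝔸.std γ i)))) i ⟨_, rfl, 𝔸.t_std γ i⟩ g'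
          ⟨chamber 𝒢 G γ, mem_chambersOf _ _⟩)
        rw [← 𝔸.atlas_eq (𝔸.t_std γ i) _ γ (mem_chambersOf _ _), map_mul,
          ← 𝔸.atlas_eq (𝔸.t_std γ i) g (𝔸.move i g' γ) hC]
        exact 𝔸.atlas_congr rfl _ _ _ _ _ h' }

@[simp]
theorem vertexAction_apply (i : I) (g : G i) (γ : GraphProduct 𝒢 G) :
    𝔸.vertexAction i g γ = 𝔸.move i g γ := rfl

theorem std_move_of_adj {i i' : I} (h : 𝒢.Adj i i') (g : G i) (γ : GraphProduct 𝒢 G) :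
    𝔸.std (𝔸.move i g γ) i' = 𝔸.std γ i' := by
  obtain ⟨h', hh⟩ := 𝔸.exists_move_eq i g γ
  rw [hh]
  exact 𝔸.isTypingMap.std_mul_of_adj (𝔸.isTypingMap.adj_std γ h.symm) h'

/-- By `move_mul`, each move keeps its displacement after the other, so the two orders give `γ`
times the same two factors, which commute. -/
theorem move_move {i i' : I} (h : 𝒢.Adj i i') (g : G i) (g' : G i') (γ : GraphProduct 𝒢 G) :
    𝔸.move i g (𝔸.move i' g' γ) = 𝔸.move i' g' (𝔸.move i g γ) := by
  have hadj := 𝔸.isTypingMap.adj_std γ h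
  obtain ⟨k, hk⟩ := 𝔸.exists_move_eq i g γ
  obtain ⟨k', hk'⟩ := 𝔸.exists_move_eq i' g' γ
  rw [hk', 𝔸.move_mul i g γ (ofVertex_mem_subgroupOf hadj k'), hk,
    𝔸.move_mul i' g' γ (ofVertex_mem_subgroupOf hadj.symm k), hk', mul_assoc, mul_assoc,
    (ofVertex_commute hadj k k').eq]

theorem vertexAction_commute {i i' : I} (h : 𝒢.Adj i i') (g : G i) (g' : G i') :
    Commute (𝔸.vertexAction i g) (𝔸.vertexAction i' g') :=
  Equiv.ext fun γ => 𝔸.move_move h g g' γ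

/-- The action of the graph product on chambers that is given by a typed atlas. -/
noncomputable def action : GraphProduct 𝒢 G →* Equiv.Perm (GraphProduct 𝒢 G) :=
  lift 𝔸.vertexAction fun _ _ h => 𝔸.vertexAction_commute h

@[simp]
theorem action_ofVertex (i : I) (g : G i) (γ : GraphProduct 𝒢 G) :
    𝔸.action (ofVertex 𝒢 G i g) γ = 𝔸.move i g γ := by
  rw [action, lift_ofVertex, vertexAction_apply]

/-! ### Simple transitivity of the action. -/

variable {I : Type u} {𝒢 : SimpleGraph I} {G : I → Type v} [∀ i, Group (G i)]
  (𝔸 : TypedAtlas 𝒢 G)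

theorem move_one (i : I) (γ : GraphProduct 𝒢 G) : 𝔸.move i 1 γ = γ := by
  rw [← vertexAction_apply, map_one, Equiv.Perm.one_apply]

theorem move_mul_left (i : I) (g g' : G i) (γ : GraphProduct 𝒢 G) :
    𝔸.move i (g * g') γ = 𝔸.move i g (𝔸.move i g' γ) := by
  simp only [← vertexAction_apply, map_mul, Equiv.Perm.mul_apply]

/-- The type `i` depends on `γ`, so the element is recorded in `Γ`, where elements for different
chambers can be multiplied. -/
theorem exists_elt (j : I) (h : G j) (γ : GraphProduct 𝒢 G) :
    ∃ x : GraphProduct 𝒢 G, ∃ (i : I) (g : G i), 𝔸.std γ i = j ∧ x = ofVertex 𝒢 G i g ∧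
      𝔸.move i g γ = γ * ofVertex 𝒢 G j h := by
  obtain ⟨i, rfl⟩ := 𝔸.isTypingMap.std_surjective γ j
  obtain ⟨g, hg, -⟩ := 𝔸.existsUnique_move_eq i γ h
  exact ⟨_, i, g, rfl, rfl, hg⟩

/-- The element of the graph product, in the image of a vertex group, that moves `C_γ` to
`C_{γh}`. -/
noncomputable def elt (j : I) (h : G j) (γ : GraphProduct 𝒢 G) : GraphProduct 𝒢 G :=
  (𝔸.exists_elt j h γ).choose

theorem elt_spec (j : I) (h : G j) (γ : GraphProduct 𝒢 G) :
    ∃ (i : I) (g : G i), 𝔸.std γ i = j ∧ 𝔸.elt j h γ = ofVertex 𝒢 G i g ∧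
      𝔸.move i g γ = γ * ofVertex 𝒢 G j h := (𝔸.exists_elt j h γ).choose_spec

theorem elt_eq {i j : I} {g : G i} {h : G j} {γ : GraphProduct 𝒢 G} (hi : 𝔸.std γ i = j)
    (hg : 𝔸.move i g γ = γ * ofVertex 𝒢 G j h) : 𝔸.elt j h γ = ofVertex 𝒢 G i g := by
  obtain ⟨i', g', hi', he, hg'⟩ := 𝔸.elt_spec j h γ
  obtain rfl := 𝔸.isTypingMap.std_injective γ (hi'.trans hi.symm)
  subst hi
  rw [he, (𝔸.existsUnique_move_eq i' γ h).unique hg' hg]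

theorem action_elt (j : I) (h : G j) (γ : GraphProduct 𝒢 G) :
    𝔸.action (𝔸.elt j h γ) γ = γ * ofVertex 𝒢 G j h := by
  obtain ⟨i, g, -, he, hg⟩ := 𝔸.elt_spec j h γ
  rw [he, action_ofVertex, hg]

theorem elt_one (j : I) (γ : GraphProduct 𝒢 G) : 𝔸.elt j 1 γ = 1 := by
  obtain ⟨i, hi⟩ := 𝔸.isTypingMap.std_surjective γ j
  rw [𝔸.elt_eq (g := 1) hi (by rw [𝔸.move_one, map_one, mul_one]), map_one]

/-- The cocycle identity: both chambers have the same vertex of type `{i}`, so the two moves come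
from one vertex group. -/
theorem elt_mul (j : I) (h h' : G j) (γ : GraphProduct 𝒢 G) :
    𝔸.elt j (h * h') γ = 𝔸.elt j h' (γ * ofVertex 𝒢 G j h) * 𝔸.elt j h γ := by
  obtain ⟨i, g, rfl, he, hg⟩ := 𝔸.elt_spec j h γ
  obtain ⟨i', g', hi', he', hg'⟩ := 𝔸.elt_spec _ h' (γ * ofVertex 𝒢 G _ h)
  obtain rfl : i' = i := 𝔸.isTypingMap.std_injective _
    (hi'.trans (𝔸.isTypingMap.std_mul_of_eq h).symm)
  rw [he, he', ← map_mul]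
  exact 𝔸.elt_eq rfl (by rw [𝔸.move_mul_left, hg, hg', map_mul, mul_assoc])

theorem elt_of_adj {j k : I} (hjk : 𝒢.Adj j k) (h : G j) (h' : G k) (γ : GraphProduct 𝒢 G) :
    𝔸.elt j h (γ * ofVertex 𝒢 G k h') = 𝔸.elt j h γ := by
  obtain ⟨i, g, rfl, he, hg⟩ := 𝔸.elt_spec j h γ
  rw [he]
  refine 𝔸.elt_eq (𝔸.isTypingMap.std_mul_of_adj hjk h') ?_
  rw [𝔸.move_mul i g γ (ofVertex_mem_subgroupOf hjk h'), hg, mul_assoc, mul_assoc,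
    (ofVertex_commute hjk h h').eq]

theorem elt_commute {j k : I} (hjk : 𝒢.Adj j k) (h : G j) (h' : G k) (γ : GraphProduct 𝒢 G) :
    Commute (𝔸.elt j h γ) (𝔸.elt k h' γ) := by
  obtain ⟨i, g, rfl, he, -⟩ := 𝔸.elt_spec j h γ
  obtain ⟨i', g', rfl, he', -⟩ := 𝔸.elt_spec k h' γ
  rw [he, he']
  exact ofVertex_commute (𝔸.isTypingMap.adj_of_adj_std hjk) g g'

/-- The action of a vertex group on pairs of a chamber `C_γ` and an element `x` of the graph
product that covers the right translations of `γ` and multiplies `x` by the element that takes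
the old chamber to the new one. -/
noncomputable def vertexTransport (j : I) :
    G j →* Equiv.Perm (GraphProduct 𝒢 G × GraphProduct 𝒢 G) :=
  MonoidHom.toHomPerm
    -- The inverses turn right translation into a left action; `elt_mul` is what multiplicativity of
    -- the second entry requires.
    { toFun := fun h p => (p.1 * ofVertex 𝒢 G j h⁻¹, 𝔸.elt j h⁻¹ p.1 * p.2)
      map_one' := by
        funext p
        simp only [inv_one, map_one, mul_one, elt_one, one_mul]
        rfl
      map_mul' := fun h h' => by
        funext p
        change _ = (_, _)
        simp only [mul_inv_rev, map_mul, elt_mul, mul_assoc] }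

theorem vertexTransport_apply (j : I) (h : G j) (p : GraphProduct 𝒢 G × GraphProduct 𝒢 G) :
    𝔸.vertexTransport j h p = (p.1 * ofVertex 𝒢 G j h⁻¹, 𝔸.elt j h⁻¹ p.1 * p.2) := rfl

theorem vertexTransport_commute {j k : I} (hjk : 𝒢.Adj j k) (h : G j) (h' : G k) :
    Commute (𝔸.vertexTransport j h) (𝔸.vertexTransport k h') := by
  refine Equiv.ext fun p => ?_
  simp only [Equiv.Perm.mul_apply, vertexTransport_apply, 𝔸.elt_of_adj hjk,
    𝔸.elt_of_adj hjk.symm, mul_assoc, (ofVertex_commute hjk h⁻¹ h'⁻¹).eq]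
  rw [(𝔸.elt_commute hjk h⁻¹ h'⁻¹ p.1).left_comm]

/-- The action of the graph product on pairs of chambers and elements. -/
noncomputable def transport :
    GraphProduct 𝒢 G →* Equiv.Perm (GraphProduct 𝒢 G × GraphProduct 𝒢 G) :=
  lift 𝔸.vertexTransport fun _ _ hjk => 𝔸.vertexTransport_commute hjk

theorem transport_ofVertex_mul (j : I) (h : G j) (u : GraphProduct 𝒢 G)
    (p : GraphProduct 𝒢 G × GraphProduct 𝒢 G) :
    𝔸.transport (ofVertex 𝒢 G j h * u) p = ((𝔸.transport u p).1 * ofVertex 𝒢 G j h⁻¹,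
      𝔸.elt j h⁻¹ (𝔸.transport u p).1 * (𝔸.transport u p).2) := by
  rw [map_mul, Equiv.Perm.mul_apply, transport, lift_ofVertex, vertexTransport_apply]

theorem transport_fst (u : GraphProduct 𝒢 G) (p : GraphProduct 𝒢 G × GraphProduct 𝒢 G) :
    (𝔸.transport u p).1 = p.1 * u⁻¹ := by
  refine induction_left (P := fun u => (𝔸.transport u p).1 = p.1 * u⁻¹) (by simp) ?_ u
  intro j h u ih
  rw [transport_ofVertex_mul, ih, mul_inv_rev, map_inv, mul_assoc]

theorem action_transport (γ u : GraphProduct 𝒢 G) :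
    𝔸.action (𝔸.transport u (γ, 1)).2 γ = (𝔸.transport u (γ, 1)).1 := by
  refine induction_left
    (P := fun u => 𝔸.action (𝔸.transport u (γ, 1)).2 γ = (𝔸.transport u (γ, 1)).1) (by simp) ?_ u
  intro j h u ih
  rw [transport_ofVertex_mul, map_mul, Equiv.Perm.mul_apply, ih, action_elt]

/-- Every move is a right translation at the current chamber, so any product of moves can be
replayed by `transport`, recording that product. -/
theorem exists_transport_eq (γ x : GraphProduct 𝒢 G) :
    ∃ u, 𝔸.transport u (γ, 1) = (𝔸.action x γ, x) := by
  refine induction_left (P := fun x => ∃ u, 𝔸.transport u (γ, 1) = (𝔸.action x γ, x))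
    ⟨1, by simp⟩ ?_ x
  rintro i g x ⟨u, hu⟩
  obtain ⟨h, hh⟩ := 𝔸.exists_move_eq i g (𝔸.action x γ)
  refine ⟨ofVertex 𝒢 G _ h⁻¹ * u, ?_⟩
  rw [transport_ofVertex_mul, hu, inv_inv, 𝔸.elt_eq rfl hh, ← hh, map_mul, Equiv.Perm.mul_apply,
    action_ofVertex]

/-- If `x` and `y` reach the same chamber, the first entries force their transporting elements to
coincide, and the second entries then give `x = y`. -/
theorem action_injective (γ : GraphProduct 𝒢 G) : Function.Injective fun x => 𝔸.action x γ := by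
  intro x y hxy
  obtain ⟨a, ha⟩ := 𝔸.exists_transport_eq γ x
  obtain ⟨b, hb⟩ := 𝔸.exists_transport_eq γ y
  have h1 := 𝔸.transport_fst a (γ, 1)
  have h2 := 𝔸.transport_fst b (γ, 1)
  rw [ha] at h1
  rw [hb] at h2
  obtain rfl : a = b := inv_injective (mul_left_cancel (h1.symm.trans (hxy.trans h2)))
  exact congrArg Prod.snd (ha.symm.trans hb)

theorem exists_action_eq (γ δ : GraphProduct 𝒢 G) : ∃ x, 𝔸.action x γ = δ :=
  ⟨_, (𝔸.action_transport γ (δ⁻¹ * γ)).trans (by rw [transport_fst]; simp)⟩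

/-! ### Developing a typed atlas into an automorphism. -/

/-- The vertex of a given type of a chamber. -/
noncomputable abbrev vert (γ : GraphProduct 𝒢 G) (J : Spherical 𝒢) : Vertex 𝒢 G :=
  𝔸.isTypingMap.vert γ J

theorem t_vert (γ : GraphProduct 𝒢 G) (J : Spherical 𝒢) : 𝔸.t (𝔸.vert γ J) = J :=
  𝔸.isTypingMap.apply_vert γ J

theorem eq_vert {γ : GraphProduct 𝒢 G} {w : Vertex 𝒢 G} (hw : w ∈ chamber 𝒢 G γ) :
    w = 𝔸.vert γ (𝔸.t w) := 𝔸.isTypingMap.eq_vert hw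

theorem vert_single (γ : GraphProduct 𝒢 G) (i : I) :
    𝔸.vert γ (Spherical.single 𝒢 i) = vtx 𝒢 G γ (Spherical.single 𝒢 (𝔸.std γ i)) :=
  𝔸.isTypingMap.vert_single γ i

theorem vert_move {i : I} {J : Spherical 𝒢} (hi : i ∈ J.1) (g : G i) (γ : GraphProduct 𝒢 G) :
    𝔸.vert (𝔸.move i g γ) J = 𝔸.vert γ J := by
  obtain ⟨h, hh⟩ := 𝔸.exists_move_eq i g γ
  have hmem : 𝔸.std γ i ∈ ((𝔸.isTypingMap.typeIso γ).symm J).1 := by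
    rwa [𝔸.isTypingMap.std_mem_iff, OrderIso.apply_symm_apply]
  have h1 : 𝔸.vert γ J ∈ chamber 𝒢 G (𝔸.move i g γ) := by
    rw [hh, vert, IsTypingMap.vert, vtx_mem_chamber_iff, inv_mul_cancel_left]
    exact ofVertex_mem_subgroupOf hmem h
  rw [𝔸.eq_vert h1, t_vert]

theorem vert_action {J : Spherical 𝒢} {x : GraphProduct 𝒢 G}
    (hx : x ∈ subgroupOf 𝒢 G (J.1 : Set I)) (γ : GraphProduct 𝒢 G) :
    𝔸.vert (𝔸.action x γ) J = 𝔸.vert γ J := by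
  refine subgroupOf_induction_left (P := fun x => 𝔸.vert (𝔸.action x γ) J = 𝔸.vert γ J)
    (by simp) ?_ hx
  intro i hi g x _ ih
  rw [map_mul, Equiv.Perm.mul_apply, action_ofVertex, 𝔸.vert_move hi, ih]

/-- Chambers sharing a vertex differ by an element of `Γ_J` for its atlas type `J`: along the way in
`Γ_K` the vertex stays fixed, so each move has its index in that type. -/
theorem exists_action_eq_mul (γ : GraphProduct 𝒢 G) {K : Spherical 𝒢} {y : GraphProduct 𝒢 G}
    (hy : y ∈ subgroupOf 𝒢 G (K.1 : Set I)) :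
    ∃ x ∈ subgroupOf 𝒢 G ((𝔸.isTypingMap.typeIso γ K).1 : Set I), 𝔸.action x γ = γ * y := by
  refine subgroupOf_induction_right (P := fun y =>
    ∃ x ∈ subgroupOf 𝒢 G ((𝔸.isTypingMap.typeIso γ K).1 : Set I), 𝔸.action x γ = γ * y)
    ⟨1, one_mem _, by simp⟩ ?_ hy
  rintro y hy j hj h ⟨x, hx, he⟩
  obtain ⟨i, g, rfl, -, hg⟩ := 𝔸.elt_spec j h (γ * y)
  have hi : i ∈ (𝔸.isTypingMap.typeIso γ K).1 := by
    rw [← 𝔸.isTypingMap.apply_vtx, ← vtx_mul hy, 𝔸.isTypingMap.apply_vtx,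
      ← 𝔸.isTypingMap.std_mem_iff]
    exact hj
  refine ⟨ofVertex 𝒢 G i g * x, mul_mem (ofVertex_mem_subgroupOf hi g) hx, ?_⟩
  rw [map_mul, Equiv.Perm.mul_apply, he, action_ofVertex, hg, mul_assoc]

/-- One direction makes the development well defined; the other, which rests on freeness of the
action, makes it injective. -/
theorem vert_action_eq_iff (γ h h' : GraphProduct 𝒢 G) (J J' : Spherical 𝒢) :
    𝔸.vert (𝔸.action h⁻¹ γ) J = 𝔸.vert (𝔸.action h'⁻¹ γ) J' ↔
      J = J' ∧ h⁻¹ * h' ∈ subgroupOf 𝒢 G (J.1 : Set I) := by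
  constructor
  · intro e
    have hJ : J = J' := by
      simpa only [t_vert] using congrArg 𝔸.t e
    subst hJ
    refine ⟨rfl, ?_⟩
    obtain ⟨x, hx, he⟩ := 𝔸.exists_action_eq_mul (𝔸.action h⁻¹ γ) (vtx_eq_iff.1 e).2
    rw [OrderIso.apply_symm_apply] at hx
    rw [mul_inv_cancel_left, ← Equiv.Perm.mul_apply, ← map_mul] at he
    have h1 : x * h⁻¹ = h'⁻¹ := 𝔸.action_injective γ he
    rw [eq_mul_inv_of_mul_eq h1] at hx
    simpa using inv_mem hx
  · rintro ⟨rfl, hx⟩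
    have := 𝔸.vert_action (inv_mem hx) (𝔸.action h⁻¹ γ)
    rw [← Equiv.Perm.mul_apply, ← map_mul] at this
    rw [← this]
    congr 3
    group

/-- The map of the building to itself that takes the standard typing map and the action of the
graph product by translations to the typing map and the action of a typed atlas. -/
noncomputable def developMap (γ : GraphProduct 𝒢 G) : Vertex 𝒢 G → Vertex 𝒢 G :=
  -- Replacing `h` by `hk` with `k ∈ Γ_J` changes `h⁻¹` to `k⁻¹h⁻¹`, and acting by `k⁻¹` fixes the
  -- vertex of type `J`.
  Quotient.lift (fun p => 𝔸.vert (𝔸.action p.1⁻¹ γ) p.2) fun p q h =>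
    (𝔸.vert_action_eq_iff γ p.1 q.1 p.2 q.2).2 h

theorem developMap_vtx (γ h : GraphProduct 𝒢 G) (J : Spherical 𝒢) :
    𝔸.developMap γ (vtx 𝒢 G h J) = 𝔸.vert (𝔸.action h⁻¹ γ) J := rfl

theorem developMap_bijective (γ : GraphProduct 𝒢 G) : Function.Bijective (𝔸.developMap γ) := by
  constructor
  · intro x y hxy
    obtain ⟨h, J, rfl⟩ := exists_eq_vtx x
    obtain ⟨h', J', rfl⟩ := exists_eq_vtx y
    exact vtx_eq_iff.2 ((𝔸.vert_action_eq_iff γ h h' J J').1 hxy)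
  · intro w
    obtain ⟨δ, J, rfl⟩ := exists_eq_vtx w
    obtain ⟨x, rfl⟩ := 𝔸.exists_action_eq γ δ
    refine ⟨vtx 𝒢 G x⁻¹ (𝔸.t (vtx 𝒢 G (𝔸.action x γ) J)), ?_⟩
    rw [developMap_vtx, inv_inv]
    exact (𝔸.eq_vert (vtx_mem_chamber _ _)).symm

/-- The permutation of the vertices given by `developMap`. -/
noncomputable def develop (γ : GraphProduct 𝒢 G) : Equiv.Perm (Vertex 𝒢 G) :=
  Equiv.ofBijective _ (𝔸.developMap_bijective γ)

theorem develop_vtx (γ h : GraphProduct 𝒢 G) (J : Spherical 𝒢) :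
    𝔸.develop γ (vtx 𝒢 G h J) = 𝔸.vert (𝔸.action h⁻¹ γ) J := rfl

theorem develop_image_cube (γ h : GraphProduct 𝒢 G) (J₁ J₂ : Spherical 𝒢) :
    𝔸.develop γ '' {w | ∃ J : Spherical 𝒢, J₁.1 ⊆ J.1 ∧ J.1 ⊆ J₂.1 ∧ w = vtx 𝒢 G h J} =
      {w | ∃ J : Spherical 𝒢, ((𝔸.isTypingMap.typeIso (𝔸.action h⁻¹ γ)).symm J₁).1 ⊆ J.1 ∧
        J.1 ⊆ ((𝔸.isTypingMap.typeIso (𝔸.action h⁻¹ γ)).symm J₂).1 ∧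
        w = vtx 𝒢 G (𝔸.action h⁻¹ γ) J} := by
  set e := 𝔸.isTypingMap.typeIso (𝔸.action h⁻¹ γ) with he
  ext w
  constructor
  · rintro ⟨_, ⟨J, h1, h2, rfl⟩, rfl⟩
    exact ⟨e.symm J, e.symm.monotone h1, e.symm.monotone h2, rfl⟩
  · rintro ⟨J, h1, h2, rfl⟩
    refine ⟨_, ⟨e J, e.symm_apply_le.1 h1, e.le_symm_apply.1 h2, rfl⟩, ?_⟩
    rw [develop_vtx, vert, IsTypingMap.vert, ← he, OrderIso.symm_apply_apply]

theorem develop_mem_AutRk (γ : GraphProduct 𝒢 G) : 𝔸.develop γ ∈ AutRk 𝒢 G := by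
  refine ⟨fun n Q => ⟨?_, ?_⟩, fun w => ?_⟩
  · rintro ⟨h, J₁, J₂, h12, hcard, rfl⟩
    exact ⟨_, _, _, (𝔸.isTypingMap.typeIso (𝔸.action h⁻¹ γ)).symm.monotone h12,
      by rwa [𝔸.isTypingMap.card_typeIso_symm, 𝔸.isTypingMap.card_typeIso_symm],
      𝔸.develop_image_cube γ h J₁ J₂⟩
  · rintro ⟨δ, K₁, K₂, h12, hcard, hQ⟩
    -- Transitivity presents the chamber of the image cube as a developed chamber, so the cube can
    -- be pulled back.
    obtain ⟨x, rfl⟩ := 𝔸.exists_action_eq γ δ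
    refine ⟨x⁻¹, 𝔸.isTypingMap.typeIso (𝔸.action x γ) K₁,
      𝔸.isTypingMap.typeIso (𝔸.action x γ) K₂, (𝔸.isTypingMap.typeIso (𝔸.action x γ)).monotone h12,
      by rwa [𝔸.isTypingMap.card_typeIso, 𝔸.isTypingMap.card_typeIso], ?_⟩
    refine (𝔸.develop γ).injective.image_injective ?_
    rw [hQ, develop_image_cube]
    simp only [inv_inv, OrderIso.symm_apply_apply]
  · obtain ⟨h, J, rfl⟩ := exists_eq_vtx w
    rw [develop_vtx, vert, IsTypingMap.vert, rk_vtx, rk_vtx, 𝔸.isTypingMap.card_typeIso_symm]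

/-! ### Transfer between two typed atlases. -/

variable {I : Type u} {𝒢 : SimpleGraph I} {G : I → Type v} [∀ i, Group (G i)]
  (𝔸 𝔸' : TypedAtlas 𝒢 G)

theorem atlas_apply {w : Vertex 𝒢 G} {i : I} (hi : (𝔸.t w).1 = {i}) (g : G i)
    {γ : GraphProduct 𝒢 G} (C : chambersOf (levelClass w))
    (hC : (C : Set (Vertex 𝒢 G)) = chamber 𝒢 G γ) :
    (𝔸.atlas (levelClass w) i ⟨w, rfl, hi⟩ g C : Set (Vertex 𝒢 G)) =
      chamber 𝒢 G (𝔸.move i g γ) := by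
  obtain ⟨C, hm⟩ := C
  dsimp only at hC
  subst hC
  exact 𝔸.atlas_eq hi g γ hm

/-- The automorphism that takes one typed atlas to another and one chamber to another. -/
noncomputable def transfer (γ γ' : GraphProduct 𝒢 G) : AutRk 𝒢 G :=
  ⟨𝔸'.develop γ' * (𝔸.develop γ)⁻¹,
    mul_mem (𝔸'.develop_mem_AutRk γ') (inv_mem (𝔸.develop_mem_AutRk γ))⟩

variable {𝔸 𝔸'}

theorem transfer_vert (γ γ' x : GraphProduct 𝒢 G) (J : Spherical 𝒢) :
    (transfer 𝔸 𝔸' γ γ').1 (𝔸.vert (𝔸.action x γ) J) = 𝔸'.vert (𝔸'.action x γ') J := by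
  have h := 𝔸.develop_vtx γ x⁻¹ J
  have h' := 𝔸'.develop_vtx γ' x⁻¹ J
  rw [inv_inv] at h h'
  rw [← h, ← h', transfer, Equiv.Perm.mul_apply, ← Equiv.Perm.mul_apply (𝔸.develop γ)⁻¹,
    inv_mul_cancel, Equiv.Perm.one_apply]

theorem apply_eq_vert_of_image_chamber {F : Equiv.Perm (Vertex 𝒢 G)}
    (ht : ∀ w, 𝔸'.t (F w) = 𝔸.t w) {δ δ' : GraphProduct 𝒢 G}
    (h : F '' chamber 𝒢 G δ = chamber 𝒢 G δ') {w : Vertex 𝒢 G} (hw : w ∈ chamber 𝒢 G δ) :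
    F w = 𝔸'.vert δ' (𝔸.t w) := by
  rw [← ht]
  exact 𝔸'.eq_vert (h ▸ Set.mem_image_of_mem F hw)

theorem t_transfer (γ γ' : GraphProduct 𝒢 G) (w : Vertex 𝒢 G) :
    𝔸'.t ((transfer 𝔸 𝔸' γ γ').1 w) = 𝔸.t w := by
  obtain ⟨δ, J, rfl⟩ := exists_eq_vtx w
  obtain ⟨x, rfl⟩ := 𝔸.exists_action_eq γ δ
  rw [𝔸.eq_vert (vtx_mem_chamber _ J), transfer_vert, 𝔸'.t_vert,
    𝔸.t_vert]

theorem transfer_image_chamber (γ γ' x : GraphProduct 𝒢 G) :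
    (transfer 𝔸 𝔸' γ γ').1 '' chamber 𝒢 G (𝔸.action x γ) = chamber 𝒢 G (𝔸'.action x γ') := by
  ext w
  constructor
  · rintro ⟨y, hy, rfl⟩
    rw [𝔸.eq_vert hy, transfer_vert]
    exact 𝔸'.isTypingMap.vert_mem_chamber _ _
  · intro hw
    rw [𝔸'.eq_vert hw, ← transfer_vert (𝔸 := 𝔸) γ]
    exact ⟨_, 𝔸.isTypingMap.vert_mem_chamber _ _, rfl⟩

theorem levelClass_vert_move {i l : I} (h : 𝒢.Adj i l) (g : G l) (γ : GraphProduct 𝒢 G) :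
    levelClass (𝔸.vert (𝔸.move l g γ) (Spherical.single 𝒢 i)) =
      levelClass (𝔸.vert γ (Spherical.single 𝒢 i)) := by
  obtain ⟨k, hk⟩ := 𝔸.exists_move_eq l g γ
  have hs : 𝔸.std (𝔸.move l g γ) i = 𝔸.std γ i := 𝔸.std_move_of_adj h.symm g γ
  rw [𝔸.vert_single, 𝔸.vert_single, hs, hk]
  exact levelClass_mul_ofVertex γ (𝔸.isTypingMap.adj_std γ h) k

/-- A generating level-adjacency is a move by some `g ∈ G l` with `l` adjacent to `i`; the transfer
carries it to the same move for the second atlas. -/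
theorem levelClass_transfer (γ γ' : GraphProduct 𝒢 G) {x y : Vertex 𝒢 G}
    (hxy : levelClass x = levelClass y) (hx : rk 𝒢 G x = 1) :
    levelClass ((transfer 𝔸 𝔸' γ γ').1 x) = levelClass ((transfer 𝔸 𝔸' γ γ').1 y) := by
  refine rel_of_levelClass_eq (r := fun x y => levelClass ((transfer 𝔸 𝔸' γ γ').1 x) =
    levelClass ((transfer 𝔸 𝔸' γ γ').1 y))
    ⟨fun _ => rfl, fun h => h.symm, fun h h' => h.trans h'⟩ (fun δ j k h hjk => ?_) hxy hx
  obtain ⟨i, rfl⟩ := 𝔸.isTypingMap.std_surjective δ j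
  obtain ⟨l, rfl⟩ := 𝔸.isTypingMap.std_surjective δ k
  have hil := 𝔸.isTypingMap.adj_of_adj_std hjk
  obtain ⟨g, hg, -⟩ := 𝔸.existsUnique_move_eq l δ h
  have hs := 𝔸.std_move_of_adj hil.symm g δ
  have h1 := 𝔸.vert_single (𝔸.move l g δ) i
  rw [hs] at h1
  rw [← hg, ← 𝔸.vert_single, ← h1]
  obtain ⟨z, rfl⟩ := 𝔸.exists_action_eq γ δ
  rw [transfer_vert, ← action_ofVertex, ← Equiv.Perm.mul_apply, ← map_mul, transfer_vert, map_mul,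
    Equiv.Perm.mul_apply, action_ofVertex, levelClass_vert_move hil]

theorem isPushforward_transfer (γ γ' : GraphProduct 𝒢 G) :
    IsPushforward (transfer 𝔸 𝔸' γ γ') 𝔸 𝔸' := by
  refine ⟨t_transfer γ γ', fun w i hi g C => ?_⟩
  obtain ⟨_, hC⟩ := C
  obtain ⟨δ, rfl⟩ := hC.1
  obtain ⟨x, rfl⟩ := 𝔸.exists_action_eq γ δ
  have hcl := 𝔸.levelClass_eq_of_mem_chambersOf hi hC
  have hC' : (transfer 𝔸 𝔸' γ γ').1 '' chamber 𝒢 G (𝔸.action x γ) ∈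
      chambersOf (levelClass ((transfer 𝔸 𝔸' γ γ').1 w)) :=
    ⟨⟨_, (transfer_image_chamber γ γ' x).symm⟩, _, ⟨_, vtx_mem_chamber _ _, rfl⟩,
      (levelClass_transfer γ γ' hcl (𝔸.rk_eq_one hi)).symm⟩
  refine ⟨hC', ?_⟩
  rw [𝔸.atlas_eq hi g _ hC, 𝔸'.atlas_apply (by rw [t_transfer, hi]) g ⟨_, hC'⟩ (transfer_image_chamber γ γ' x),
    ← action_ofVertex, ← action_ofVertex, ← Equiv.Perm.mul_apply, ← Equiv.Perm.mul_apply,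
    ← map_mul, ← map_mul, transfer_image_chamber]

/-- Equivariance under each vertex group extends to all of `Γ` by induction on words; this yields
uniqueness. -/
theorem _root_.RAB.IsPushforward.image_chamber {F : AutRk 𝒢 G} (hF : IsPushforward F 𝔸 𝔸')
    {γ γ' : GraphProduct 𝒢 G} (h : F.1 '' chamber 𝒢 G γ = chamber 𝒢 G γ')
    (x : GraphProduct 𝒢 G) :
    F.1 '' chamber 𝒢 G (𝔸.action x γ) = chamber 𝒢 G (𝔸'.action x γ') := by
  obtain ⟨ht, hF⟩ := hF
  refine induction_left
    (P := fun x => F.1 '' chamber 𝒢 G (𝔸.action x γ) = chamber 𝒢 G (𝔸'.action x γ'))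
    (by simpa using h) ?_ x
  intro i g x ih
  obtain ⟨hC, he⟩ := hF _ i (𝔸.t_std (𝔸.action x γ) i) g ⟨_, mem_chambersOf _ _⟩
  rw [𝔸.atlas_eq (𝔸.t_std _ i), 𝔸'.atlas_apply (by rw [ht, 𝔸.t_std]) g ⟨_, hC⟩ ih] at he
  rw [map_mul, map_mul, Equiv.Perm.mul_apply, Equiv.Perm.mul_apply, action_ofVertex,
    action_ofVertex, he]

end TypedAtlas

end RAB

/-! ### The proposition. -/

theorem mainTheorem11 {I : Type*} [Finite I] (𝒢 : SimpleGraph I) (G : I → Type*)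
    [∀ i, Group (G i)] [∀ i, Finite (G i)]
    (𝔸 𝔸' : RAB.TypedAtlas 𝒢 G) (γ γ' : RAB.GraphProduct 𝒢 G) :
    (∃! f : RAB.chamber 𝒢 G γ ≃ RAB.chamber 𝒢 G γ',
      RAB.IsCubicalIso f ∧ ∀ w : RAB.chamber 𝒢 G γ, 𝔸'.t (f w) = 𝔸.t w) ∧
    ∀ f : RAB.chamber 𝒢 G γ ≃ RAB.chamber 𝒢 G γ', RAB.IsCubicalIso f →
      (∀ w : RAB.chamber 𝒢 G γ, 𝔸'.t (f w) = 𝔸.t w) →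
      ∃! F : RAB.AutRk 𝒢 G,
        (∀ w : RAB.chamber 𝒢 G γ, F.1 w = f w) ∧ RAB.IsPushforward F 𝔸 𝔸' := by
  have hval : ∀ f : RAB.chamber 𝒢 G γ ≃ RAB.chamber 𝒢 G γ',
      (∀ w : RAB.chamber 𝒢 G γ, 𝔸'.t (f w) = 𝔸.t w) →
      ∀ w : RAB.chamber 𝒢 G γ, (f w : RAB.Vertex 𝒢 G) = 𝔸'.vert γ' (𝔸.t w) := fun f hf w => by
    rw [𝔸'.eq_vert (f w).2, hf]
  constructor
  · obtain ⟨φ, hφ, -, ht⟩ := 𝔸.isTypingMap.exists_iso γ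
    obtain ⟨φ', hφ', -, ht'⟩ := 𝔸'.isTypingMap.exists_iso γ'
    have hty : ∀ w : RAB.chamber 𝒢 G γ, 𝔸'.t (φ.trans φ'.symm w) = 𝔸.t w := fun w => by
      rw [ht', ht, Equiv.trans_apply, Equiv.apply_symm_apply]
    refine ⟨φ.trans φ'.symm, ⟨hφ.trans hφ'.symm, hty⟩, fun f hf => ?_⟩
    exact Equiv.ext fun w => Subtype.ext ((hval f hf.2 w).trans (hval _ hty w).symm)
  · intro f _ hf
    have hbase : ∀ F : RAB.AutRk 𝒢 G, (∀ w : RAB.chamber 𝒢 G γ, F.1 w = f w) →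
        F.1 '' RAB.chamber 𝒢 G γ = RAB.chamber 𝒢 G γ' := fun F hF => by
      ext w
      constructor
      · rintro ⟨y, hy, rfl⟩
        rw [hF ⟨y, hy⟩]
        exact (f _).2
      · intro hw
        obtain ⟨y, hy⟩ := f.surjective ⟨w, hw⟩
        exact ⟨y, y.2, by rw [hF, hy]⟩
    refine ⟨RAB.TypedAtlas.transfer 𝔸 𝔸' γ γ', ⟨fun w => ?_,
      RAB.TypedAtlas.isPushforward_transfer γ γ'⟩, fun F hF => ?_⟩
    -- At the identity element, the transfer sends each vertex of the first chamber to the vertex of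
    -- the same type in the second, which is `f`.
    · have h := RAB.TypedAtlas.transfer_vert (𝔸 := 𝔸) (𝔸' := 𝔸') γ γ' 1 (𝔸.t w)
      rw [map_one, map_one, Equiv.Perm.one_apply, Equiv.Perm.one_apply] at h
      rw [hval f hf w, ← h]
      exact congrArg _ (𝔸.eq_vert w.2)
    · refine Subtype.ext (Equiv.ext fun w => ?_)
      obtain ⟨δ, J, rfl⟩ := RAB.exists_eq_vtx w
      obtain ⟨x, rfl⟩ := 𝔸.exists_action_eq γ δ
      have hw := RAB.vtx_mem_chamber (𝔸.action x γ) J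
      obtain ⟨ht, -⟩ := id hF.2
      rw [RAB.TypedAtlas.apply_eq_vert_of_image_chamber ht (hF.2.image_chamber (hbase F hF.1) x) hw,
        RAB.TypedAtlas.apply_eq_vert_of_image_chamber
          (RAB.TypedAtlas.t_transfer γ γ')
          (RAB.TypedAtlas.transfer_image_chamber γ γ' x) hw]
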